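/- All algebras are unital over $\mathbb{C}$ and $\otimes=\otimes_{\mathbb C}$. Let $A$ be a Hopf $*$-algebra, let $H$ be a compact quantum group algebra (a Hopf $*$-algebra spanned by the matrix coefficients of its finite-dimensional unitary corepresentations), and let $\pi:A\to H$ be a surjective homomorphism of Hopf $*$-algebras. Put $B=A^{\mathrm{co}(H)}=\{a\in A:(\mathrm{id}\otimes\pi)\Delta(a)=a\otimes 1\}$, and assume that $B$ is a quantum homogeneous space, i.e. that $A$ is faithfully flat as a right $B$-module. $B$ is a left $A$-comodule $*$-algebra via $\Delta$; put $B^+=B\cap\ker\epsilon$. Let ${}^A_B\mathrm{Mod}_B$ be the category of $B$-bimodules $M$ with a left $A$-coaction $m\mapsto m_{(-1)}\otimes m_{(0)}$ such that $bmc\mapsto b_{(1)}m_{(-1)}c_{(1)}\otimes b_{(2)}m_{(0)}c_{(2)}$ for $b,c\in B$, $m\in M$, with the $B$-bilinear $A$-colinear maps as morphisms, and let ${}^A_B\mathrm{mod}_0$ be its full subcategory of those $M$ that are finitely generated as left $B$-modules and satisfy $MB^+=B^+M$. Let $(\Omega^\bullet,\wedge,d)$ be an $A$-covariant differential $*$-calculus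 on $B$ (a differential graded algebra with $\Omega^0=B$, generated by $B$ and $dB$, with a graded conjugate-linear involution that extends $*$ on $B$, commutes with $d$ and satisfies $(\omega\wedge\nu)^*=(-1)^{kl}\nu^*\wedge\omega^*$ for $\omega\in\Omega^k$, $\nu\in\Omega^l$, and with a coaction that extends that of $B$, preserves the degree, commutes with $d$ and makes $\Omega^\bullet$ a comodule $*$-algebra). Let it carry an $A$-covariant complex structure: an $\mathbb{N}_0^2$-algebra grading $\Omega^\bullet=\bigoplus\Omega^{(p,q)}$ by subcomodules with $\Omega^k=\bigoplus_{p+q=k}\Omega^{(p,q)}$, $(\Omega^{(p,q)})^*=\Omega^{(q,p)}$ and $d\,\Omega^{(p,q)}\subseteq\Omega^{(p+1,q)}\oplus\Omega^{(p,q+1)}$. Assume that $\Omega^1$ is an object of ${}^A_B\mathrm{mod}_0$ and that $\Omega^{(1,0)}$ and $\Omega^{(0,1)}$ are non-isomorphic simple objects of ${}^A_B\mathrm{mod}_0$. Let $(g,(\ ,\ ))$ be a real $A$-covariant metric on $\Omega^1$: $g\in\Omega^1\otimes_B\Omega^1$ and $(\ ,\ ):\Omega^1\otimes_B\Omega^1\to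 B$ is $B$-bilinear with $((\omega,\ )\otimes_B\mathrm{id})g=\omega=(\mathrm{id}\otimes_B(\ ,\omega))g$ for all $\omega\in\Omega^1$; the maps $(\ ,\ )$ and $b\mapsto bg$ are $A$-colinear; and $g^\dagger=g$, where $(\omega\otimes_B\eta)^\dagger=\eta^*\otimes_B\omega^*$. For a $B$-bimodule $E$ let $\overline E=\{\overline e:e\in E\}$ be the conjugate vector space with $b\cdot\overline e=\overline{e\cdot b^*}$, $\overline e\cdot b=\overline{b^*\cdot e}$, and let ${}_B\mathrm{Hom}(E,B)$ be the bimodule of left $B$-linear maps with $(b\cdot f)(e)=f(e\cdot b)$, $(f\cdot b)(e)=f(e)b$. A Hermitian metric on $E$ is a bimodule isomorphism $\mathscr H:\overline E\to{}_B\mathrm{Hom}(E,B)$ with $(\mathscr H(\overline e)(f))^*=\mathscr H(\overline f)(e)$ for all $e,f\in E$. For $E$ in ${}^A_B\mathrm{Mod}_B$ it is $A$-covariant if it is colinear for the coactions $\overline e\mapsto e_{(-1)}^*\otimes\overline{e_{(0)}}$ and $f\mapsto f_{(-1)}\otimes f_{(0)}$, where $f_{(-1)}\otimes f_{(0)}(e)=S(e_{(-1)})\,[f(e_{(0)})]_{(-1)}\otimes[f(e_{(0)})]_{(0)}$.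 Then $\mathscr H:\overline{\Omega^1}\to{}_B\mathrm{Hom}(\Omega^1,B)$, $\mathscr H(\overline\omega)(\eta)=(\eta,\omega^*)$, is an $A$-covariant Hermitian metric on $\Omega^1$. The maps $$\mathscr H_1:\overline{\Omega^{(1,0)}}\to{}_B\mathrm{Hom}(\Omega^{(1,0)},B),\qquad \mathscr H_2:\overline{\Omega^{(0,1)}}\to{}_B\mathrm{Hom}(\Omega^{(0,1)},B),\qquad \mathscr H_i(\overline\omega)(\eta)=(\eta,\omega^*),$$ are $A$-covariant Hermitian metrics on $\Omega^{(1,0)}$ and $\Omega^{(0,1)}$ respectively, and $\mathscr H=\mathscr H_1\oplus\mathscr H_2$ with respect to $\Omega^1=\Omega^{(1,0)}\oplus\Omega^{(0,1)}$. -/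

import Mathlib

open scoped TensorProduct

universe u

set_option linter.unusedSectionVars false

noncomputable section

namespace QHS

/-! ### Hopf `*`-algebras, compact quantum group algebras -/

/-- `A` is a Hopf `*`-algebra: a complex Hopf algebra and a `*`-algebra whose coproduct is a `*`-map.
(Compatibility of the counit with `*`, the identity `S ∘ * ∘ S ∘ * = id` and hence bijectivity of
the antipode are automatic.) -/
class HopfStarAlgebra (A : Type u) [Ring A] [HopfAlgebra ℂ A] [StarRing A] [StarModule ℂ A] :
    Prop where
  comul_star : ∀ a : A, Coalgebra.comul (R := ℂ) (star a) = star (Coalgebra.comul (R := ℂ) a)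

/-- `H` is a compact quantum group algebra: a Hopf `*`-algebra that is spanned by the matrix
coefficients of its finite-dimensional unitary corepresentations. -/
def IsCQGAlgebra (H : Type u) [Ring H] [HopfAlgebra ℂ H] [StarRing H] [StarModule ℂ H] : Prop :=
  HopfStarAlgebra H ∧
  Submodule.span ℂ {h : H | ∃ (n : ℕ) (v : Matrix (Fin n) (Fin n) H),
    (∀ i j, Coalgebra.comul (R := ℂ) (v i j) = ∑ k, v i k ⊗ₜ[ℂ] v k j) ∧
    v.conjTranspose * v = 1 ∧ v * v.conjTranspose = 1 ∧ ∃ i j, v i j = h} = ⊤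

/-! ### Comodules -/

section Comodule

variable (A : Type u) [Ring A] [HopfAlgebra ℂ A]
variable (M : Type u) [AddCommGroup M] [Module ℂ M]

/-- A left `A`-comodule structure `m ↦ m₍₋₁₎ ⊗ m₍₀₎` on `M`. -/
structure Coaction where
  toLin : M →ₗ[ℂ] A ⊗[ℂ] M
  coassoc : (TensorProduct.assoc ℂ A A M).toLinearMap ∘ₗ
    (Coalgebra.comul (R := ℂ) (A := A)).rTensor M ∘ₗ toLin = toLin.lTensor A ∘ₗ toLin
  counit : (Coalgebra.counit (R := ℂ) (A := A)).rTensor M ∘ₗ toLin = TensorProduct.mk ℂ ℂ M 1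

/-- `A` as a left comodule over itself. -/
def Coaction.self : Coaction A A where
  toLin := Coalgebra.comul
  coassoc := Coalgebra.coassoc
  counit := Coalgebra.rTensor_counit_comp_comul

variable {A M}
variable {N : Type u} [AddCommGroup N] [Module ℂ N]

theorem lTensor_injective (A : Type u) [Ring A] [HopfAlgebra ℂ A] {N M : Type u}
    [AddCommGroup N] [Module ℂ N] [AddCommGroup M] [Module ℂ M]
    {i : N →ₗ[ℂ] M} (hi : Function.Injective i) : Function.Injective (i.lTensor A) :=
  Module.Flat.lTensor_preserves_injective_linearMap i hi

/-- The image of `i : N → M` is a subcomodule: the coaction maps it into `A ⊗ N`. -/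
def Coaction.Stable (ρ : Coaction A M) (i : N →ₗ[ℂ] M) : Prop :=
  ∀ n, ρ.toLin (i n) ∈ LinearMap.range (i.lTensor A)

/-- The underlying map of the coaction restricted along an injection `i`. -/
def Coaction.restrictLin (ρ : Coaction A M) (i : N →ₗ[ℂ] M) (hi : Function.Injective i)
    (h : ρ.Stable i) : N →ₗ[ℂ] A ⊗[ℂ] N :=
  (LinearEquiv.ofInjective (i.lTensor A) (lTensor_injective A hi)).symm.toLinearMap ∘ₗ
    (ρ.toLin ∘ₗ i).codRestrict (LinearMap.range (i.lTensor A)) h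

theorem Coaction.lTensor_restrictLin (ρ : Coaction A M) (i : N →ₗ[ℂ] M)
    (hi : Function.Injective i) (h : ρ.Stable i) (n : N) :
    i.lTensor A (ρ.restrictLin i hi h n) = ρ.toLin (i n) := by
  have := (LinearEquiv.ofInjective (i.lTensor A) (lTensor_injective A hi)).apply_symm_apply
    ((ρ.toLin ∘ₗ i).codRestrict (LinearMap.range (i.lTensor A)) h n)
  exact congrArg Subtype.val this

/-- The coaction restricted to a subcomodule; it is characterised by
`Coaction.lTensor_restrictLin`. -/
def Coaction.restrict (ρ : Coaction A M) (i : N →ₗ[ℂ] M) (hi : Function.Injective i)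
    (h : ρ.Stable i) : Coaction A N where
  toLin := ρ.restrictLin i hi h
  coassoc := by
    have key : i.lTensor A ∘ₗ ρ.restrictLin i hi h = ρ.toLin ∘ₗ i :=
      LinearMap.ext (ρ.lTensor_restrictLin i hi h)
    apply LinearMap.ext
    intro n
    apply lTensor_injective A (lTensor_injective A hi)
    have e1 : ∀ t : (A ⊗[ℂ] A) ⊗[ℂ] N, (i.lTensor A).lTensor A (TensorProduct.assoc ℂ A A N t)
        = TensorProduct.assoc ℂ A A M (i.lTensor (A ⊗[ℂ] A) t) := by
      intro t
      induction t using TensorProduct.induction_on with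
      | zero => simp
      | add x y hx hy => simp only [map_add, hx, hy]
      | tmul x y =>
        induction x using TensorProduct.induction_on with
        | zero => simp
        | add x z hx hz => simp only [TensorProduct.add_tmul, map_add, hx, hz]
        | tmul x z => simp
    have e2 : ∀ t : A ⊗[ℂ] N, i.lTensor (A ⊗[ℂ] A)
        ((Coalgebra.comul (R := ℂ) (A := A)).rTensor N t)
        = (Coalgebra.comul (R := ℂ) (A := A)).rTensor M (i.lTensor A t) := by
      intro t
      rw [← LinearMap.comp_apply, ← LinearMap.comp_apply, LinearMap.lTensor_comp_rTensor,
        LinearMap.rTensor_comp_lTensor]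
    have e3 : ∀ t : A ⊗[ℂ] N, (i.lTensor A).lTensor A ((ρ.restrictLin i hi h).lTensor A t)
        = (ρ.toLin).lTensor A (i.lTensor A t) := by
      intro t
      rw [← LinearMap.comp_apply, ← LinearMap.comp_apply, ← LinearMap.lTensor_comp,
        ← LinearMap.lTensor_comp, key]
    simp only [LinearMap.comp_apply, LinearEquiv.coe_coe]
    rw [e1, e2, e3, ρ.lTensor_restrictLin i hi h]
    exact LinearMap.congr_fun ρ.coassoc (i n)
  counit := by
    apply LinearMap.ext
    intro n
    have hinj : Function.Injective (i.lTensor ℂ) :=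
      Module.Flat.lTensor_preserves_injective_linearMap i hi
    apply hinj
    have e2 : ∀ t : A ⊗[ℂ] N, i.lTensor ℂ
        ((Coalgebra.counit (R := ℂ) (A := A)).rTensor N t)
        = (Coalgebra.counit (R := ℂ) (A := A)).rTensor M (i.lTensor A t) := by
      intro t
      rw [← LinearMap.comp_apply, ← LinearMap.comp_apply, LinearMap.lTensor_comp_rTensor,
        LinearMap.rTensor_comp_lTensor]
    simp only [LinearMap.comp_apply]
    rw [e2, ρ.lTensor_restrictLin i hi h]
    simpa using LinearMap.congr_fun ρ.counit (i n)

end Comodule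

/-! ### Bimodules and the tensor product over a noncommutative algebra `B`

A `B`-bimodule is a complex vector space with commuting actions of `B` and `Bᵐᵒᵖ`, compatible with
the scalars; the right action is `m · b = MulOpposite.op b • m`. -/

section Bimodule

variable (B : Type u) [Ring B] [Algebra ℂ B]

section Actions

variable (M : Type u) [AddCommGroup M] [Module ℂ M]

/-- The left action `b ⊗ m ↦ b · m` as a complex bilinear map. -/
def leftAct [Module B M] [IsScalarTower ℂ B M] : B →ₗ[ℂ] M →ₗ[ℂ] M :=
  (Algebra.lsmul ℂ ℂ M).toLinearMap

/-- The right action `m ⊗ b ↦ m · b` as a complex bilinear map. -/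
def rightAct [Module Bᵐᵒᵖ M] [IsScalarTower ℂ Bᵐᵒᵖ M] : M →ₗ[ℂ] B →ₗ[ℂ] M :=
  LinearMap.mk₂ ℂ (fun m b => MulOpposite.op b • m)
    (fun m m' b => smul_add _ m m') (fun c m b => smul_comm _ c m)
    (fun m b b' => by rw [MulOpposite.op_add, add_smul])
    (fun c m b => by rw [MulOpposite.op_smul, smul_assoc])

end Actions

section Tensor

variable (M N : Type u) [AddCommGroup M] [Module ℂ M] [Module Bᵐᵒᵖ M]
  [AddCommGroup N] [Module ℂ N] [Module B N]

/-- The relations `(m · b) ⊗ n = m ⊗ (b · n)`. -/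
def balanced : Submodule ℂ (M ⊗[ℂ] N) :=
  Submodule.span ℂ {t | ∃ (m : M) (b : B) (n : N),
    t = (MulOpposite.op b • m) ⊗ₜ[ℂ] n - m ⊗ₜ[ℂ] (b • n)}

/-- The tensor product `M ⊗_B N` of a right and a left `B`-module. -/
abbrev BTensor : Type u := (M ⊗[ℂ] N) ⧸ balanced B M N

variable {M N}

/-- The pure tensor `m ⊗_B n`. -/
def BTensor.tmul (m : M) (n : N) : BTensor B M N := (balanced B M N).mkQ (m ⊗ₜ[ℂ] n)

theorem BTensor.op_smul_tmul (m : M) (b : B) (n : N) :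
    BTensor.tmul B (MulOpposite.op b • m) n = BTensor.tmul B m (b • n) := by
  unfold BTensor.tmul
  rw [← sub_eq_zero, ← map_sub]
  exact (Submodule.Quotient.mk_eq_zero _).2 (Submodule.subset_span ⟨m, b, n, rfl⟩)

variable (M N)

/-- `(m, n) ↦ m ⊗_B n` as a complex bilinear map. -/
def BTensor.mkBilin : M →ₗ[ℂ] N →ₗ[ℂ] BTensor B M N :=
  (TensorProduct.mk ℂ M N).compr₂ (balanced B M N).mkQ

variable {M N}
variable {σ : ℂ →+* ℂ} {P : Type u} [AddCommGroup P] [Module ℂ P]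

/-- A (semi)linear map on `M ⊗_ℂ N` that is balanced over `B` descends to `M ⊗_B N`. -/
def BTensor.lift (f : M ⊗[ℂ] N →ₛₗ[σ] P)
    (h : ∀ (m : M) (b : B) (n : N), f ((MulOpposite.op b • m) ⊗ₜ[ℂ] n) = f (m ⊗ₜ[ℂ] (b • n))) :
    BTensor B M N →ₛₗ[σ] P :=
  (balanced B M N).liftQ f <| by
    refine Submodule.span_le.2 ?_
    rintro _ ⟨m, b, n, rfl⟩
    simp only [SetLike.mem_coe, LinearMap.mem_ker, map_sub, h, sub_self]

@[simp] theorem BTensor.lift_tmul (f : M ⊗[ℂ] N →ₛₗ[σ] P)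
    (h : ∀ (m : M) (b : B) (n : N), f ((MulOpposite.op b • m) ⊗ₜ[ℂ] n) = f (m ⊗ₜ[ℂ] (b • n)))
    (m : M) (n : N) : BTensor.lift B f h (BTensor.tmul B m n) = f (m ⊗ₜ[ℂ] n) := rfl

/-- The map `id ⊗_B f : M ⊗_B N → M ⊗_B N'` for a left `B`-linear map `f`. -/
def BTensor.lMap [IsScalarTower ℂ B N] {N' : Type u} [AddCommGroup N'] [Module ℂ N']
    [Module B N'] [IsScalarTower ℂ B N'] (f : N →ₗ[B] N') : BTensor B M N →ₗ[ℂ] BTensor B M N' :=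
  BTensor.lift B ((balanced B M N').mkQ ∘ₗ (f.restrictScalars ℂ).lTensor M) <| by
    intro m b n
    have := BTensor.op_smul_tmul B m b (f n)
    simpa [BTensor.tmul] using this

/-- The left action of `b` on `M ⊗_B N`: `b · (m ⊗ n) = (b · m) ⊗ n`. -/
def BTensor.lsmul [Module B M] [SMulCommClass B Bᵐᵒᵖ M] [IsScalarTower ℂ B M] (b : B) :
    BTensor B M N →ₗ[ℂ] BTensor B M N :=
  BTensor.lift B ((balanced B M N).mkQ ∘ₗ (leftAct B M b).rTensor N) <| by
    intro m c n
    have := BTensor.op_smul_tmul B (b • m) c n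
    simpa [BTensor.tmul, leftAct, smul_comm b (MulOpposite.op c) m] using this

/-- The map `B → M ⊗_B N`, `b ↦ b · g`, attached to an element `g` of `M ⊗_B N`. -/
def BTensor.coev [Module B M] [SMulCommClass B Bᵐᵒᵖ M] [IsScalarTower ℂ B M]
    (g : BTensor B M N) : B →ₗ[ℂ] BTensor B M N where
  toFun b := BTensor.lsmul B b g
  map_add' b c := by
    obtain ⟨t, rfl⟩ := (balanced B M N).mkQ_surjective g
    change (balanced B M N).mkQ _ = (balanced B M N).mkQ _ + (balanced B M N).mkQ _
    rw [← map_add, map_add, LinearMap.rTensor_add, LinearMap.add_apply]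
  map_smul' c b := by
    obtain ⟨t, rfl⟩ := (balanced B M N).mkQ_surjective g
    change (balanced B M N).mkQ _ = c • (balanced B M N).mkQ _
    rw [← map_smul, map_smul, LinearMap.rTensor_smul, LinearMap.smul_apply]

variable (M) in
/-- The right `B`-module `M` is faithfully flat: a sequence of left `B`-modules
`N₁ → N₂ → N₃` is exact if and only if `M ⊗_B N₁ → M ⊗_B N₂ → M ⊗_B N₃` is exact. -/
def RightFaithfullyFlat : Prop :=
  ∀ (N₁ N₂ N₃ : Type u) [AddCommGroup N₁] [Module ℂ N₁] [Module B N₁] [IsScalarTower ℂ B N₁]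
    [AddCommGroup N₂] [Module ℂ N₂] [Module B N₂] [IsScalarTower ℂ B N₂]
    [AddCommGroup N₃] [Module ℂ N₃] [Module B N₃] [IsScalarTower ℂ B N₃]
    (f : N₁ →ₗ[B] N₂) (f' : N₂ →ₗ[B] N₃),
    Function.Exact (BTensor.lMap B (M := M) f) (BTensor.lMap B (M := M) f') ↔ Function.Exact f f'

end Tensor

/-- Sub-bimodules of a `B`-bimodule. -/
structure SubBimodule (M : Type u) [AddCommGroup M] [Module B M] [Module Bᵐᵒᵖ M] extends
    Submodule B M where
  op_smul_mem : ∀ (b : B) {m : M}, m ∈ carrier → MulOpposite.op b • m ∈ carrier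

namespace SubBimodule

variable {B} {M : Type u} [AddCommGroup M] [Module ℂ M] [Module B M] [Module Bᵐᵒᵖ M]
  [IsScalarTower ℂ B M] [IsScalarTower ℂ Bᵐᵒᵖ M] [SMulCommClass B Bᵐᵒᵖ M]

instance : CoeSort (SubBimodule B M) (Type u) := ⟨fun N => ↥N.toSubmodule⟩

instance (N : SubBimodule B M) : Module Bᵐᵒᵖ N.toSubmodule where
  smul b m := ⟨b • (m : M), N.op_smul_mem b.unop m.2⟩
  one_smul m := Subtype.ext (one_smul _ (m : M))
  mul_smul a b m := Subtype.ext (mul_smul a b (m : M))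
  smul_zero a := Subtype.ext (smul_zero a)
  smul_add a m n := Subtype.ext (smul_add a (m : M) (n : M))
  add_smul a b m := Subtype.ext (add_smul a b (m : M))
  zero_smul m := Subtype.ext (zero_smul _ (m : M))

theorem coe_op_smul (N : SubBimodule B M) (b : Bᵐᵒᵖ) (m : N) : ((b • m : N) : M) = b • (m : M) :=
  rfl

instance (N : SubBimodule B M) : IsScalarTower ℂ Bᵐᵒᵖ N.toSubmodule :=
  ⟨fun a b m => Subtype.ext (smul_assoc a b (m : M))⟩

instance (N : SubBimodule B M) : SMulCommClass B Bᵐᵒᵖ N.toSubmodule :=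
  ⟨fun a b m => Subtype.ext (smul_comm a b (m : M))⟩

/-- The inclusion of a sub-bimodule as a complex linear map. -/
def incl (N : SubBimodule B M) : N →ₗ[ℂ] M := N.toSubmodule.subtype.restrictScalars ℂ

theorem incl_injective (N : SubBimodule B M) : Function.Injective N.incl :=
  Subtype.val_injective

end SubBimodule

end Bimodule

/-! ### Relative Hopf modules -/

section RelHopf

variable {A : Type u} [Ring A] [HopfAlgebra ℂ A]
variable {B : Type u} [Ring B] [Algebra ℂ B]

variable {M : Type u} [AddCommGroup M] [Module ℂ M] [Module B M] [Module Bᵐᵒᵖ M]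
  [IsScalarTower ℂ B M] [IsScalarTower ℂ Bᵐᵒᵖ M] [SMulCommClass B Bᵐᵒᵖ M]
variable {N : Type u} [AddCommGroup N] [Module ℂ N] [Module B N] [Module Bᵐᵒᵖ N]
  [IsScalarTower ℂ B N] [IsScalarTower ℂ Bᵐᵒᵖ N] [SMulCommClass B Bᵐᵒᵖ N]

/-- `M` is an object of the category of relative Hopf modules: the coaction satisfies
`δ(b m c) = b₍₁₎ m₍₋₁₎ c₍₁₎ ⊗ b₍₂₎ m₍₀₎ c₍₂₎`. -/
structure IsRelHopf (ρB : Coaction A B) (ρM : Coaction A M) : Prop where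
  smul : ∀ (b : B) (m : M), ρM.toLin (b • m) =
    TensorProduct.map₂ (LinearMap.mul ℂ A) (leftAct B M) (ρB.toLin b) (ρM.toLin m)
  op_smul : ∀ (b : B) (m : M), ρM.toLin (MulOpposite.op b • m) =
    TensorProduct.map₂ (LinearMap.mul ℂ A) (rightAct B M) (ρM.toLin m) (ρB.toLin b)

/-- The diagonal coaction `m ⊗_B n ↦ m₍₋₁₎ n₍₋₁₎ ⊗ (m₍₀₎ ⊗_B n₍₀₎)` on `M ⊗_B N`. -/
def tensorCoact {ρB : Coaction A B} {ρM : Coaction A M} {ρN : Coaction A N}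
    (hM : IsRelHopf ρB ρM) (hN : IsRelHopf ρB ρN) : BTensor B M N →ₗ[ℂ] A ⊗[ℂ] BTensor B M N :=
  BTensor.lift B
    (TensorProduct.lift
      ((TensorProduct.map₂ (LinearMap.mul ℂ A) (BTensor.mkBilin B M N)).compl₁₂
        ρM.toLin ρN.toLin)) <| by
    intro m b n
    have key : ∀ (X : A ⊗[ℂ] M) (β : A ⊗[ℂ] B) (Y : A ⊗[ℂ] N),
        TensorProduct.map₂ (LinearMap.mul ℂ A) (BTensor.mkBilin B M N)
          (TensorProduct.map₂ (LinearMap.mul ℂ A) (rightAct B M) X β) Y =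
        TensorProduct.map₂ (LinearMap.mul ℂ A) (BTensor.mkBilin B M N) X
          (TensorProduct.map₂ (LinearMap.mul ℂ A) (leftAct B N) β Y) := by
      intro X β Y
      induction X using TensorProduct.induction_on with
      | zero => simp
      | add X X' h h' => simp only [map_add, LinearMap.add_apply, h, h']
      | tmul a m =>
        induction β using TensorProduct.induction_on with
        | zero => simp
        | add X X' h h' => simp only [map_add, LinearMap.add_apply, h, h']
        | tmul a' b =>
          induction Y using TensorProduct.induction_on with
          | zero => simp
          | add X X' h h' => simp only [map_add, h, h']
          | tmul a'' n =>
            have := BTensor.op_smul_tmul B m b n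
            simp only [BTensor.tmul] at this
            simp [BTensor.mkBilin, rightAct, leftAct, mul_assoc, this]
    simp only [TensorProduct.lift.tmul, LinearMap.compl₁₂_apply, hM.op_smul, hN.smul, key]

/-- `M` is finitely generated as a left `B`-module and `M B⁺ = B⁺ M` (where `P` is `B⁺`). -/
structure IsModzObject (P : Submodule ℂ B) (M : Type u) [AddCommGroup M] [Module ℂ M]
    [Module B M] [Module Bᵐᵒᵖ M] : Prop where
  finite : Module.Finite B M
  comm : Submodule.span ℂ {x : M | ∃ b ∈ P, ∃ m : M, x = MulOpposite.op b • m} =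
    Submodule.span ℂ {x : M | ∃ b ∈ P, ∃ m : M, x = b • m}

/-- `M` is a simple object: a nonzero object whose only subobjects are `0` and `M`; subobjects are
the sub-bimodules that are subcomodules and are themselves objects of the category. -/
structure IsSimpleModz (P : Submodule ℂ B) (ρM : Coaction A M) : Prop where
  isObject : IsModzObject P M
  nontrivial : Nontrivial M
  eq_bot_or_eq_top : ∀ K : SubBimodule B M, ρM.Stable K.incl → IsModzObject P K →
    K.toSubmodule = ⊥ ∨ K.toSubmodule = ⊤

/-- `M` and `N` are isomorphic relative Hopf modules: there is a bijective `B`-bilinear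
`A`-colinear map between them. -/
def IsIsoRelHopf (ρM : Coaction A M) (ρN : Coaction A N) : Prop :=
  ∃ f : M ≃ₗ[B] N, (∀ (b : B) (m : M), f (MulOpposite.op b • m) = MulOpposite.op b • f m) ∧
    ∀ m, ρN.toLin (f m) = (f.toLinearMap.restrictScalars ℂ).lTensor A (ρM.toLin m)

end RelHopf

/-! ### The conjugate of a bimodule -/

/-- The conjugate `M̄ = {m̄ : m ∈ M}` of a vector space. -/
@[ext] structure Conj (M : Type u) : Type u where
  bar ::
  unbar : M

namespace Conj

section

variable {M : Type u} [AddCommGroup M]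

/-- The bijection `M̄ ≃ M`. -/
def equiv (M : Type u) : Conj M ≃ M := ⟨unbar, bar, fun _ => rfl, fun _ => rfl⟩

instance : AddCommGroup (Conj M) := (equiv M).addCommGroup

theorem bar_add (m n : M) : bar (m + n) = bar m + bar n := rfl

/-- Scalars act by `c · m̄ = \overline{c̄ · m}`. -/
instance [Module ℂ M] : Module ℂ (Conj M) where
  smul c x := bar (star c • x.unbar)
  one_smul x := congrArg bar (by simp)
  mul_smul c d x := congrArg bar (by rw [star_mul', mul_smul]; rfl)
  smul_zero c := congrArg bar (smul_zero _)
  smul_add c x y := congrArg bar (smul_add _ _ _)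
  add_smul c d x := congrArg bar (by rw [star_add, add_smul]; rfl)
  zero_smul x := congrArg bar (by simp)

theorem smul_bar [Module ℂ M] (c : ℂ) (m : M) : c • bar m = bar (star c • m) := rfl

/-- `m ↦ m̄` as a conjugate-linear map. -/
def barL (M : Type u) [AddCommGroup M] [Module ℂ M] : M →ₛₗ[starRingEnd ℂ] Conj M where
  toFun := bar
  map_add' _ _ := rfl
  map_smul' c m := by rw [smul_bar]; simp

variable {B : Type u} [Ring B] [StarRing B]

/-- `b · m̄ = \overline{m · b*}`. -/
instance [Module Bᵐᵒᵖ M] : Module B (Conj M) where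
  smul b x := bar (MulOpposite.op (star b) • x.unbar)
  one_smul x := congrArg bar (by simp)
  mul_smul c d x := congrArg bar (by rw [star_mul, MulOpposite.op_mul, mul_smul]; rfl)
  smul_zero c := congrArg bar (smul_zero _)
  smul_add c x y := congrArg bar (smul_add _ _ _)
  add_smul c d x := congrArg bar (by rw [star_add, MulOpposite.op_add, add_smul]; rfl)
  zero_smul x := congrArg bar (by simp)

/-- `m̄ · b = \overline{b* · m}`. -/
instance [Module B M] : Module Bᵐᵒᵖ (Conj M) where
  smul b x := bar (star b.unop • x.unbar)
  one_smul x := congrArg bar (by simp)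
  mul_smul c d x := congrArg bar (by rw [MulOpposite.unop_mul, star_mul, mul_smul]; rfl)
  smul_zero c := congrArg bar (smul_zero _)
  smul_add c x y := congrArg bar (smul_add _ _ _)
  add_smul c d x := congrArg bar (by rw [MulOpposite.unop_add, star_add, add_smul]; rfl)
  zero_smul x := congrArg bar (by simp)

end

variable {A : Type u} [Ring A] [HopfAlgebra ℂ A] [StarRing A] [StarModule ℂ A]
variable {M : Type u} [AddCommGroup M] [Module ℂ M]

/-- The map `A ⊗ M → A ⊗ M̄`, `a ⊗ m ↦ a* ⊗ m̄`. -/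
def tensorBar (A : Type u) [Ring A] [HopfAlgebra ℂ A] [StarRing A] [StarModule ℂ A]
    (M : Type u) [AddCommGroup M] [Module ℂ M] :
    A ⊗[ℂ] M →ₛₗ[starRingEnd ℂ] A ⊗[ℂ] Conj M :=
  TensorProduct.map (starLinearEquiv ℂ (A := A)).toLinearMap (barL M)

/-- The coaction `m̄ ↦ m₍₋₁₎* ⊗ \overline{m₍₀₎}` on `M̄`. -/
def coact (ρ : Coaction A M) : Conj M →ₗ[ℂ] A ⊗[ℂ] Conj M where
  toFun x := tensorBar A M (ρ.toLin x.unbar)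
  map_add' x y := by
    rw [← map_add, ← map_add]; rfl
  map_smul' c x := by
    change tensorBar A M (ρ.toLin (star c • x.unbar)) = _
    rw [map_smul, LinearMap.map_smulₛₗ]; simp

end Conj

/-! ### Hermitian metrics -/

section Hermitian

variable {A : Type u} [Ring A] [HopfAlgebra ℂ A] [StarRing A] [StarModule ℂ A]
variable {B : Type u} [Ring B] [Algebra ℂ B] [StarRing B] [StarModule ℂ B]
variable {E : Type u} [AddCommGroup E] [Module ℂ E] [Module B E] [Module Bᵐᵒᵖ E]
  [IsScalarTower ℂ B E] [IsScalarTower ℂ Bᵐᵒᵖ E] [SMulCommClass B Bᵐᵒᵖ E]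

/-- The left action on the left dual: `(b · f)(m) = f(m · b)`. -/
def dualSMul (b : B) (f : E →ₗ[B] B) : E →ₗ[B] B where
  toFun m := f (MulOpposite.op b • m)
  map_add' m n := by rw [smul_add, map_add]
  map_smul' c m := by rw [← smul_comm c, map_smul]; rfl

/-- The right action on the left dual: `(f · b)(m) = f(m) b`. -/
def dualOpSMul (f : E →ₗ[B] B) (b : B) : E →ₗ[B] B where
  toFun m := f m * b
  map_add' m n := by rw [map_add, add_mul]
  map_smul' c m := by simp [mul_assoc]

/-- Evaluation at `m` of elements of the left dual. -/
def dualEval (B : Type u) [Ring B] [Algebra ℂ B] {E : Type u} [AddCommGroup E]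
    [Module B E] (m : E) : (E →ₗ[B] B) →ₗ[ℂ] B where
  toFun f := f m
  map_add' _ _ := rfl
  map_smul' _ _ := rfl

/-- The map `m ↦ S(m₍₋₁₎) f(m₍₀₎)₍₋₁₎ ⊗ f(m₍₀₎)₍₀₎` from `E` to `A ⊗ B` attached to `f` in the left
dual of `E`. -/
def dualCoactMap (ρB : Coaction A B) (ρE : Coaction A E) (f : E →ₗ[B] B) : E →ₗ[ℂ] A ⊗[ℂ] B :=
  (LinearMap.mul' ℂ A).rTensor B ∘ₗ (TensorProduct.assoc ℂ A A B).symm.toLinearMap ∘ₗ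
    TensorProduct.map (HopfAlgebra.antipode ℂ) (ρB.toLin ∘ₗ f.restrictScalars ℂ) ∘ₗ ρE.toLin

/-- `t = f₍₋₁₎ ⊗ f₍₀₎` is the value of the coaction of the left dual of `E` at `f`, which is
determined by `f₍₋₁₎ ⊗ f₍₀₎(m) = S(m₍₋₁₎) f(m₍₀₎)₍₋₁₎ ⊗ f(m₍₀₎)₍₀₎` for all `m`. -/
def IsDualCoact (ρB : Coaction A B) (ρE : Coaction A E) (f : E →ₗ[B] B)
    (t : A ⊗[ℂ] (E →ₗ[B] B)) : Prop :=
  ∀ m : E, (dualEval B m).lTensor A t = dualCoactMap ρB ρE f m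

theorem IsDualCoact.unique {ρB : Coaction A B} {ρE : Coaction A E} {f : E →ₗ[B] B}
    {t t' : A ⊗[ℂ] (E →ₗ[B] B)} (h : IsDualCoact ρB ρE f t) (h' : IsDualCoact ρB ρE f t') :
    t = t' := by
  classical
  let β := Module.Basis.ofVectorSpace ℂ A
  have e : ∀ (m : E) (t : A ⊗[ℂ] (E →ₗ[B] B)) (i), TensorProduct.equivFinsuppOfBasisLeft β
      ((dualEval B m).lTensor A t) i = (TensorProduct.equivFinsuppOfBasisLeft β t i) m := by
    intro m t i
    induction t using TensorProduct.induction_on with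
    | zero => simp
    | add x y hx hy => simp only [map_add, Finsupp.add_apply, hx, hy, LinearMap.add_apply]
    | tmul a f => simp [dualEval]
  apply (TensorProduct.equivFinsuppOfBasisLeft β).injective
  ext i m
  rw [← e, ← e, h m, h' m]

/-- A (nondegenerate) Hermitian metric on the bimodule `E`: a bimodule isomorphism `h` from `Ē` to
the left dual of `E` such that `⟨f, ē⟩* = ⟨e, f̄⟩`, where `⟨e, f̄⟩ = h(f̄)(e)`. -/
structure IsHermitianMetric (h : Conj E →ₗ[ℂ] (E →ₗ[B] B)) : Prop where
  bijective : Function.Bijective h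
  map_smul : ∀ (b : B) (x : Conj E), h (b • x) = dualSMul b (h x)
  map_op_smul : ∀ (b : B) (x : Conj E), h (MulOpposite.op b • x) = dualOpSMul (h x) b
  symm : ∀ e f : E, star (h (Conj.bar e) f) = h (Conj.bar f) e

/-- An `A`-covariant Hermitian metric: `h` is moreover `A`-colinear. -/
structure IsCovariantHermitianMetric (ρB : Coaction A B) (ρE : Coaction A E)
    (h : Conj E →ₗ[ℂ] (E →ₗ[B] B)) : Prop extends IsHermitianMetric h where
  colinear : ∀ x : Conj E, IsDualCoact ρB ρE (h x) (h.lTensor A (Conj.coact ρE x))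

/-- `h = h₁ ⊕ h₂` with respect to a decomposition `M = E ⊕ F` given by the inclusions `i` and `j`,
where the left dual of `M` is the direct sum of the left duals of `E` and `F`. -/
structure IsDirectSum {M F : Type u} [AddCommGroup M] [Module ℂ M] [Module B M]
    [IsScalarTower ℂ B M] [AddCommGroup F] [Module ℂ F] [Module B F] [IsScalarTower ℂ B F]
    (i : E →ₗ[B] M) (j : F →ₗ[B] M) (h : Conj M →ₗ[ℂ] (M →ₗ[B] B))
    (h₁ : Conj E →ₗ[ℂ] (E →ₗ[B] B)) (h₂ : Conj F →ₗ[ℂ] (F →ₗ[B] B)) : Prop where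
  decomp : Function.Bijective fun x : E × F => i x.1 + j x.2
  apply : ∀ (ω η : E) (ω' η' : F), h (Conj.bar (i ω + j ω')) (i η + j η') =
    h₁ (Conj.bar ω) η + h₂ (Conj.bar ω') η'

end Hermitian

/-! ### Metrics on a bimodule -/

section Metric

variable {A : Type u} [Ring A] [HopfAlgebra ℂ A]
variable {B : Type u} [Ring B] [Algebra ℂ B]

/-- A conjugate-linear involution of a bimodule over a `*`-algebra with `(b m c)* = c* m* b*`. -/
structure BimoduleStar (B : Type u) [Ring B] [StarRing B]
    (M : Type u) [AddCommGroup M] [Module ℂ M] [Module B M] [Module Bᵐᵒᵖ M] where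
  toLin : M →ₛₗ[starRingEnd ℂ] M
  invol : ∀ m, toLin (toLin m) = m
  map_smul : ∀ (b : B) (m : M), toLin (b • m) = MulOpposite.op (star b) • toLin m
  map_op_smul : ∀ (b : B) (m : M), toLin (MulOpposite.op b • m) = star b • toLin m

/-- A `B`-bilinear map `( , ) : M ⊗_B M → B`. -/
structure BilinPairing (B : Type u) [Ring B] [Algebra ℂ B]
    (M : Type u) [AddCommGroup M] [Module ℂ M] [Module B M] [Module Bᵐᵒᵖ M] where
  toLin : BTensor B M M →ₗ[ℂ] B
  map_smul : ∀ (b : B) (x y : M),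
    toLin (BTensor.tmul B (b • x) y) = b * toLin (BTensor.tmul B x y)
  map_op_smul : ∀ (b : B) (x y : M),
    toLin (BTensor.tmul B x (MulOpposite.op b • y)) = toLin (BTensor.tmul B x y) * b

variable {M : Type u} [AddCommGroup M] [Module ℂ M] [Module B M] [Module Bᵐᵒᵖ M]
  [IsScalarTower ℂ B M] [IsScalarTower ℂ Bᵐᵒᵖ M] [SMulCommClass B Bᵐᵒᵖ M]

namespace BilinPairing

variable (p : BilinPairing B M)

/-- The value `(x, y)`. -/
def val (x y : M) : B := p.toLin (BTensor.tmul B x y)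

/-- `(x, y)` as a complex bilinear map. -/
def bilin : M →ₗ[ℂ] M →ₗ[ℂ] B := (BTensor.mkBilin B M M).compr₂ p.toLin

theorem bilin_apply (x y : M) : p.bilin x y = p.val x y := rfl

/-- The map `(w, ) ⊗_B id : M ⊗_B M → M`, `x ⊗ y ↦ (w, x) y`. -/
def contractLeft (w : M) : BTensor B M M →ₗ[ℂ] M :=
  BTensor.lift B (TensorProduct.lift ((leftAct B M) ∘ₗ p.bilin w)) <| by
    intro m b n
    have := p.map_op_smul b w m
    simp only [TensorProduct.lift.tmul, LinearMap.comp_apply, bilin_apply, val, this]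
    simp [leftAct]

/-- The map `id ⊗_B ( , w) : M ⊗_B M → M`, `x ⊗ y ↦ x (y, w)`. -/
def contractRight (w : M) : BTensor B M M →ₗ[ℂ] M :=
  BTensor.lift B (TensorProduct.lift ((rightAct B M).compl₂ (p.bilin.flip w))) <| by
    intro m b n
    have := p.map_smul b n w
    simp only [TensorProduct.lift.tmul, LinearMap.compl₂_apply, LinearMap.flip_apply,
      bilin_apply, val, this]
    simp [rightAct, mul_smul]

end BilinPairing

/-- A metric `(g, ( , ))` on the bimodule `M`. -/
structure Metric (B : Type u) [Ring B] [Algebra ℂ B]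
    (M : Type u) [AddCommGroup M] [Module ℂ M] [Module B M] [Module Bᵐᵒᵖ M]
    [IsScalarTower ℂ B M] [IsScalarTower ℂ Bᵐᵒᵖ M] extends BilinPairing B M where
  g : BTensor B M M
  contractLeft_g : ∀ w, toBilinPairing.contractLeft w g = w
  contractRight_g : ∀ w, toBilinPairing.contractRight w g = w

/-- The metric is `A`-covariant: `( , )` and `b ↦ b g` are `A`-colinear. -/
structure Metric.IsCovariant (G : Metric B M) {ρB : Coaction A B} {ρM : Coaction A M}
    (hM : IsRelHopf ρB ρM) : Prop where
  pairing : ∀ t : BTensor B M M,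
    ρB.toLin (G.toLin t) = G.toLin.lTensor A (tensorCoact hM hM t)
  coev : ∀ b : B, tensorCoact hM hM (BTensor.coev B G.g b) =
    (BTensor.coev B G.g).lTensor A (ρB.toLin b)

variable [StarRing B] [StarModule ℂ B]

/-- The conjugate-linear map `† : M ⊗_B M → M ⊗_B M`, `x ⊗ y ↦ y* ⊗ x*`. -/
def BimoduleStar.dagger (s : BimoduleStar B M) :
    BTensor B M M →ₛₗ[starRingEnd ℂ] BTensor B M M :=
  BTensor.lift B (((balanced B M M).mkQ ∘ₗ (TensorProduct.comm ℂ M M).toLinearMap).comp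
    (TensorProduct.map s.toLin s.toLin)) <| by
    intro m b n
    have := BTensor.op_smul_tmul B (s.toLin n) (star b) (s.toLin m)
    simp only [BTensor.tmul] at this
    simp only [LinearMap.comp_apply, TensorProduct.map_tmul, LinearEquiv.coe_coe,
      TensorProduct.comm_tmul, s.map_smul, s.map_op_smul, this]

/-- The metric is real: `g† = g`. -/
def Metric.IsReal (G : Metric B M) (s : BimoduleStar B M) : Prop := s.dagger G.g = G.g

/-- The map `ω̄ ↦ (η ↦ (η, ω*))` from `Ē` to the left dual of `E`, where `E` is a left `B`-module
that is included in `M` by `i`. -/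
def Metric.form (G : Metric B M) (s : BimoduleStar B M) {E : Type u} [AddCommGroup E]
    [Module ℂ E] [Module B E] [IsScalarTower ℂ B E] (i : E →ₗ[B] M) :
    Conj E →ₗ[ℂ] (E →ₗ[B] B) where
  toFun x :=
    { toFun := fun e => G.val (i e) (s.toLin (i x.unbar))
      map_add' := fun e e' => by
        simp only [← G.bilin_apply, map_add, LinearMap.add_apply]
      map_smul' := fun b e => by
        rw [map_smul]; exact G.toBilinPairing.map_smul b _ _ }
  map_add' x y := by
    ext e
    change G.val (i e) (s.toLin (i (x.unbar + y.unbar))) = G.val _ _ + G.val _ _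
    simp only [← G.bilin_apply, map_add]
  map_smul' c x := by
    ext e
    change G.val (i e) (s.toLin (i (star c • x.unbar))) = c • G.val _ _
    have h : i (star c • x.unbar) = star c • i x.unbar := (i.restrictScalars ℂ).map_smul _ _
    rw [h, LinearMap.map_smulₛₗ, ← G.bilin_apply, ← G.bilin_apply, map_smul]
    simp

end Metric

/-! ### Differential calculi -/

/-- A differential calculus over `B`: a differential graded algebra `(Ω, ∧, d)` with `Ω⁰ = B`
(through `ι`) that is generated as an algebra by `B` and `dB`. -/
structure DiffCalculus (B : Type u) [Ring B] [Algebra ℂ B] where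
  Ω : Type u
  [ring : Ring Ω]
  [algebra : Algebra ℂ Ω]
  gr : ℕ → Submodule ℂ Ω
  gradedMonoid : SetLike.GradedMonoid gr
  isInternal : DirectSum.IsInternal gr
  ι : B →ₐ[ℂ] Ω
  ι_injective : Function.Injective ι
  range_ι : LinearMap.range ι.toLinearMap = gr 0
  d : Ω →ₗ[ℂ] Ω
  d_mem : ∀ {k : ℕ} {ω : Ω}, ω ∈ gr k → d ω ∈ gr (k + 1)
  d_d : ∀ ω, d (d ω) = 0
  leibniz : ∀ {k : ℕ} {ω : Ω} (ν : Ω), ω ∈ gr k → d (ω * ν) = d ω * ν + (-1 : ℂ) ^ k • (ω * d ν)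
  generated : Algebra.adjoin ℂ (Set.range ι ∪ Set.range fun b => d (ι b)) = ⊤

attribute [instance] DiffCalculus.ring DiffCalculus.algebra

namespace DiffCalculus

variable {B : Type u} [Ring B] [Algebra ℂ B] (D : DiffCalculus B)

instance : Module B D.Ω := Module.compHom D.Ω D.ι.toRingHom

instance : Module Bᵐᵒᵖ D.Ω := Module.compHom D.Ω (RingHom.op D.ι.toRingHom)

theorem smul_def (b : B) (ω : D.Ω) : b • ω = D.ι b * ω := rfl

theorem op_smul_def (b : B) (ω : D.Ω) : MulOpposite.op b • ω = ω * D.ι b := rfl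

instance : IsScalarTower ℂ B D.Ω :=
  ⟨fun c b ω => by simp only [smul_def, map_smul, smul_mul_assoc]⟩

instance : IsScalarTower ℂ Bᵐᵒᵖ D.Ω :=
  ⟨fun c b ω => by
    change ω * D.ι (c • b.unop) = c • (ω * D.ι b.unop)
    rw [map_smul, mul_smul_comm]⟩

instance : SMulCommClass B Bᵐᵒᵖ D.Ω :=
  ⟨fun b c ω => by
    change D.ι b * (ω * D.ι c.unop) = (D.ι b * ω) * D.ι c.unop
    rw [mul_assoc]⟩

theorem ι_mem (b : B) : D.ι b ∈ D.gr 0 := D.range_ι ▸ LinearMap.mem_range_self _ b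

/-- The bimodule `Ωᵏ`. -/
def forms (k : ℕ) : SubBimodule B D.Ω where
  carrier := D.gr k
  add_mem' h h' := (D.gr k).add_mem h h'
  zero_mem' := (D.gr k).zero_mem
  smul_mem' b ω h := by
    have := D.gradedMonoid.mul_mem (D.ι_mem b) h
    rwa [zero_add] at this
  op_smul_mem b ω h := by
    have := D.gradedMonoid.mul_mem h (D.ι_mem b)
    rwa [add_zero] at this

/-- A `*`-structure on a differential calculus over a `*`-algebra. -/
structure StarStructure [StarRing B] where
  toLin : D.Ω →ₛₗ[starRingEnd ℂ] D.Ω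
  invol : ∀ ω, toLin (toLin ω) = ω
  map_ι : ∀ b, toLin (D.ι b) = D.ι (star b)
  mem : ∀ {k : ℕ} {ω : D.Ω}, ω ∈ D.gr k → toLin ω ∈ D.gr k
  map_d : ∀ ω, D.d (toLin ω) = toLin (D.d ω)
  map_mul : ∀ {k l : ℕ} {ω ν : D.Ω}, ω ∈ D.gr k → ν ∈ D.gr l →
    toLin (ω * ν) = (-1 : ℂ) ^ (k * l) • (toLin ν * toLin ω)

variable {D}

/-- The involution of `Ωᵏ`. -/
def StarStructure.onForms [StarRing B] (S : D.StarStructure) (k : ℕ) :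
    BimoduleStar B (D.forms k) where
  toLin :=
    { toFun := fun ω => ⟨S.toLin ω, S.mem ω.2⟩
      map_add' := fun ω ν => Subtype.ext (map_add S.toLin (ω : D.Ω) (ν : D.Ω))
      map_smul' := fun c ω => Subtype.ext (LinearMap.map_smulₛₗ S.toLin c (ω : D.Ω)) }
  invol ω := Subtype.ext (S.invol ω)
  map_smul b ω := Subtype.ext <| by
    have := S.map_mul (D.ι_mem b) ω.2
    rw [S.map_ι, zero_mul, pow_zero, one_smul] at this
    exact this
  map_op_smul b ω := Subtype.ext <| by
    have := S.map_mul ω.2 (D.ι_mem b)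
    rw [S.map_ι, mul_zero, pow_zero, one_smul] at this
    exact this

/-- `A`-covariance of a differential `*`-calculus over a left `A`-comodule `*`-algebra `B`: the
coaction of `B` extends to a coaction `δ` on `Ω` that makes it a comodule `*`-algebra, preserves the
degree and commutes with `d`. -/
structure Covariance {A : Type u} [Ring A] [HopfAlgebra ℂ A] [StarRing A] [StarModule ℂ A]
    [StarRing B] (ρB : Coaction A B) (S : D.StarStructure) where
  δ : Coaction A D.Ω
  map_ι : ∀ b, δ.toLin (D.ι b) = D.ι.toLinearMap.lTensor A (ρB.toLin b)
  map_one : δ.toLin 1 = 1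
  map_mul : ∀ ω ν, δ.toLin (ω * ν) = δ.toLin ω * δ.toLin ν
  stable : ∀ k, δ.Stable (D.forms k).incl
  map_d : ∀ ω, δ.toLin (D.d ω) = D.d.lTensor A (δ.toLin ω)
  map_star : ∀ ω, δ.toLin (S.toLin ω) =
    TensorProduct.map (starLinearEquiv ℂ (A := A)).toLinearMap S.toLin (δ.toLin ω)

/-- A complex structure: an `ℕ²`-algebra grading `Ω = ⊕ Ω^(p,q)` with
`Ωᵏ = ⊕_{p+q=k} Ω^(p,q)`, `(Ω^(p,q))* = Ω^(q,p)` and `d Ω^(p,q) ⊆ Ω^(p+1,q) ⊕ Ω^(p,q+1)`. -/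
structure ComplexStructure [StarRing B] (S : D.StarStructure) where
  bigr : ℕ × ℕ → Submodule ℂ D.Ω
  gradedMonoid : SetLike.GradedMonoid bigr
  isInternal : DirectSum.IsInternal bigr
  gr_eq : ∀ k, D.gr k = ⨆ (p : ℕ) (q : ℕ) (_ : p + q = k), bigr (p, q)
  star_eq : ∀ p q, (bigr (p, q)).map S.toLin = bigr (q, p)
  d_mem : ∀ {p q : ℕ} {ω : D.Ω}, ω ∈ bigr (p, q) → D.d ω ∈ bigr (p + 1, q) ⊔ bigr (p, q + 1)

namespace ComplexStructure

variable [StarRing B] {S : D.StarStructure} (K : ComplexStructure S)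

theorem ι_mem (b : B) : D.ι b ∈ K.bigr (0, 0) := by
  have h := D.ι_mem b
  rw [K.gr_eq 0] at h
  refine (iSup_le fun p => iSup_le fun q => iSup_le fun e => ?_ :
    (⨆ (p : ℕ) (q : ℕ) (_ : p + q = 0), K.bigr (p, q)) ≤ K.bigr (0, 0)) h
  obtain ⟨rfl, rfl⟩ := Nat.add_eq_zero_iff.1 e
  exact le_rfl

/-- The bimodule `Ω^(p,q)`. -/
def forms (p q : ℕ) : SubBimodule B D.Ω where
  carrier := K.bigr (p, q)
  add_mem' h h' := (K.bigr (p, q)).add_mem h h'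
  zero_mem' := (K.bigr (p, q)).zero_mem
  smul_mem' b ω h := by
    have := K.gradedMonoid.mul_mem (K.ι_mem b) h
    rwa [Prod.mk_add_mk, zero_add, zero_add] at this
  op_smul_mem b ω h := by
    have := K.gradedMonoid.mul_mem h (K.ι_mem b)
    rwa [Prod.mk_add_mk, add_zero, add_zero] at this

theorem forms_le (p q : ℕ) : (K.forms p q).toSubmodule ≤ (D.forms (p + q)).toSubmodule := by
  intro ω hω
  change ω ∈ D.gr (p + q)
  rw [K.gr_eq]
  exact Submodule.mem_iSup_of_mem p (Submodule.mem_iSup_of_mem q (Submodule.mem_iSup_of_mem rfl hω))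

/-- The inclusion `Ω^(1,0) → Ω¹`. -/
def incl10 : K.forms 1 0 →ₗ[B] D.forms 1 := Submodule.inclusion (K.forms_le 1 0)

/-- The inclusion `Ω^(0,1) → Ω¹`. -/
def incl01 : K.forms 0 1 →ₗ[B] D.forms 1 := Submodule.inclusion (K.forms_le 0 1)

/-- The complex structure on a covariant calculus is `A`-covariant: each `Ω^(p,q)` is a
subcomodule. -/
def IsCovariant {A : Type u} [Ring A] [HopfAlgebra ℂ A] [StarRing A] [StarModule ℂ A]
    {ρB : Coaction A B} (C : Covariance ρB S) : Prop :=
  ∀ p q, C.δ.Stable (K.forms p q).incl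

end ComplexStructure

section CovariantForms

variable {A : Type u} [Ring A] [HopfAlgebra ℂ A] [StarRing A] [StarModule ℂ A] [StarRing B]
  {ρB : Coaction A B} {S : D.StarStructure}

/-- The coaction on `Ωᵏ`. -/
def Covariance.onForms (C : Covariance ρB S) (k : ℕ) : Coaction A (D.forms k) :=
  C.δ.restrict (D.forms k).incl (D.forms k).incl_injective (C.stable k)

/-- The coaction on `Ω^(p,q)`. -/
def ComplexStructure.IsCovariant.onForms {K : ComplexStructure S} {C : Covariance ρB S}
    (h : K.IsCovariant C) (p q : ℕ) : Coaction A (K.forms p q) :=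
  C.δ.restrict (K.forms p q).incl (K.forms p q).incl_injective (h p q)

theorem Covariance.isRelHopf (C : Covariance ρB S) : IsRelHopf ρB C.δ where
  smul b ω := by
    rw [smul_def, C.map_mul, C.map_ι]
    generalize ρB.toLin b = X
    generalize C.δ.toLin ω = Y
    induction X using TensorProduct.induction_on with
    | zero => simp
    | add X X' h h' => simp only [map_add, LinearMap.add_apply, add_mul, h, h']
    | tmul a b =>
      induction Y using TensorProduct.induction_on with
      | zero => simp
      | add X X' h h' => simp only [map_add, mul_add, h, h']
      | tmul a' ω => simp [leftAct, smul_def]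
  op_smul b ω := by
    rw [op_smul_def, C.map_mul, C.map_ι]
    generalize ρB.toLin b = X
    generalize C.δ.toLin ω = Y
    induction X using TensorProduct.induction_on with
    | zero => simp
    | add X X' h h' => simp only [map_add, mul_add, h, h']
    | tmul a b =>
      induction Y using TensorProduct.induction_on with
      | zero => simp
      | add X X' h h' => simp only [map_add, LinearMap.add_apply, add_mul, h, h']
      | tmul a' ω => simp [rightAct, op_smul_def]

end CovariantForms

end DiffCalculus

section RestrictRelHopf

variable {A : Type u} [Ring A] [HopfAlgebra ℂ A]
variable {B : Type u} [Ring B] [Algebra ℂ B]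
variable {M : Type u} [AddCommGroup M] [Module ℂ M] [Module B M] [Module Bᵐᵒᵖ M]
  [IsScalarTower ℂ B M] [IsScalarTower ℂ Bᵐᵒᵖ M] [SMulCommClass B Bᵐᵒᵖ M]

/-- A sub-bimodule that is a subcomodule of a relative Hopf module is a relative Hopf module. -/
theorem IsRelHopf.restrict {ρB : Coaction A B} {ρM : Coaction A M} (hM : IsRelHopf ρB ρM)
    (N : SubBimodule B M) (h : ρM.Stable N.incl) :
    IsRelHopf ρB (ρM.restrict N.incl N.incl_injective h) where
  smul b n := by
    apply lTensor_injective A N.incl_injective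
    have e : ∀ (X : A ⊗[ℂ] B) (Y : A ⊗[ℂ] N),
        N.incl.lTensor A (TensorProduct.map₂ (LinearMap.mul ℂ A) (leftAct B N) X Y) =
        TensorProduct.map₂ (LinearMap.mul ℂ A) (leftAct B M) X (N.incl.lTensor A Y) := by
      intro X Y
      induction X using TensorProduct.induction_on with
      | zero => simp
      | add X X' h h' => simp only [map_add, LinearMap.add_apply, h, h']
      | tmul a b =>
        induction Y using TensorProduct.induction_on with
        | zero => simp
        | add X X' h h' => simp only [map_add, h, h']
        | tmul a' n => simp [leftAct, SubBimodule.incl]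
    have r := fun n => ρM.lTensor_restrictLin N.incl N.incl_injective h n
    change N.incl.lTensor A (ρM.restrictLin _ N.incl_injective h _) = N.incl.lTensor A
      (TensorProduct.map₂ _ _ _ (ρM.restrictLin _ N.incl_injective h _))
    rw [e, r, r]
    exact hM.smul b n
  op_smul b n := by
    apply lTensor_injective A N.incl_injective
    have e : ∀ (X : A ⊗[ℂ] B) (Y : A ⊗[ℂ] N),
        N.incl.lTensor A (TensorProduct.map₂ (LinearMap.mul ℂ A) (rightAct B N) Y X) =
        TensorProduct.map₂ (LinearMap.mul ℂ A) (rightAct B M) (N.incl.lTensor A Y) X := by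
      intro X Y
      induction X using TensorProduct.induction_on with
      | zero => simp
      | add X X' h h' => simp only [map_add, h, h']
      | tmul a b =>
        induction Y using TensorProduct.induction_on with
        | zero => simp
        | add X X' h h' => simp only [map_add, LinearMap.add_apply, h, h']
        | tmul a' n => simp [rightAct, SubBimodule.incl, SubBimodule.coe_op_smul]
    have r := fun n => ρM.lTensor_restrictLin N.incl N.incl_injective h n
    change N.incl.lTensor A (ρM.restrictLin _ N.incl_injective h _) = N.incl.lTensor A
      (TensorProduct.map₂ _ _ (ρM.restrictLin _ N.incl_injective h _) _)
    rw [e, r, r]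
    exact hM.op_smul b n

/-- `Ωᵏ` is a relative Hopf module. -/
theorem DiffCalculus.Covariance.isRelHopf_onForms [StarRing A] [StarModule ℂ A] [StarRing B]
    {D : DiffCalculus B} {ρB : Coaction A B} {S : D.StarStructure} (C : D.Covariance ρB S)
    (k : ℕ) : IsRelHopf ρB (C.onForms k) :=
  C.isRelHopf.restrict (D.forms k) (C.stable k)

end RestrictRelHopf

/-! ### Quantum homogeneous spaces -/

/-- A surjective homomorphism `π : A → H` of Hopf `*`-algebras. -/
structure HopfSurj (A H : Type u) [Ring A] [HopfAlgebra ℂ A] [StarRing A] [StarModule ℂ A]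
    [Ring H] [HopfAlgebra ℂ H] [StarRing H] [StarModule ℂ H] where
  π : A →ₐc[ℂ] H
  surjective : Function.Surjective π
  map_star : ∀ a, π (star a) = star (π a)

namespace HopfSurj

variable {A H : Type u} [Ring A] [HopfAlgebra ℂ A] [StarRing A] [StarModule ℂ A]
  [Ring H] [HopfAlgebra ℂ H] [StarRing H] [StarModule ℂ H] (p : HopfSurj A H)

/-- The right coaction `(id ⊗ π) ∘ Δ : A → A ⊗ H`. -/
def rightCoact : A →ₐ[ℂ] A ⊗[ℂ] H :=
  (Algebra.TensorProduct.map (AlgHom.id ℂ A) (p.π : A →ₐ[ℂ] H)).comp (Bialgebra.comulAlgHom ℂ A)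

variable [HopfStarAlgebra A]

/-- The coinvariant `*`-subalgebra `B = {a : (id ⊗ π) Δ(a) = a ⊗ 1}`. -/
def coinv : StarSubalgebra ℂ A where
  toSubalgebra := AlgHom.equalizer p.rightCoact Algebra.TensorProduct.includeLeft
  star_mem' := by
    intro a ha
    have ha : p.rightCoact a = a ⊗ₜ[ℂ] 1 := ha
    change p.rightCoact (star a) = star a ⊗ₜ[ℂ] 1
    have e : ∀ t : A ⊗[ℂ] A,
        Algebra.TensorProduct.map (AlgHom.id ℂ A) (p.π : A →ₐ[ℂ] H) (star t) =
        star (Algebra.TensorProduct.map (AlgHom.id ℂ A) (p.π : A →ₐ[ℂ] H) t) := by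
      intro t
      induction t using TensorProduct.induction_on with
      | zero => simp
      | add x y hx hy => simp only [star_add, map_add, hx, hy]
      | tmul x y => simp [p.map_star]
    have h1 : p.rightCoact (star a) = star (p.rightCoact a) := by
      simp only [rightCoact, AlgHom.comp_apply, Bialgebra.comulAlgHom_apply,
        HopfStarAlgebra.comul_star, e]
    rw [h1, ha]
    simp

theorem mem_coinv {a : A} : a ∈ p.coinv ↔
    (p.π : A →ₐ[ℂ] H).toLinearMap.lTensor A (Coalgebra.comul (R := ℂ) a) = a ⊗ₜ[ℂ] 1 := Iff.rfl

/-- The inclusion `B → A`. -/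
def incl : p.coinv →ₗ[ℂ] A := p.coinv.subtype.toAlgHom.toLinearMap

theorem incl_injective : Function.Injective p.incl := Subtype.val_injective

/-- The coproduct maps `B` into `A ⊗ B`. -/
theorem stable : (Coaction.self A).Stable p.incl := by
  intro b
  let φ : A →ₗ[ℂ] H := (p.π : A →ₐ[ℂ] H).toLinearMap
  let Δ : A →ₗ[ℂ] A ⊗[ℂ] A := Coalgebra.comul
  let j : A →ₗ[ℂ] A ⊗[ℂ] H := (TensorProduct.mk ℂ A H).flip 1
  have hex : Function.Exact p.incl (φ.lTensor A ∘ₗ Δ - j) := by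
    intro a
    rw [LinearMap.sub_apply, sub_eq_zero]
    constructor
    · intro h
      exact ⟨⟨a, p.mem_coinv.2 h⟩, rfl⟩
    · rintro ⟨c, rfl⟩
      exact p.mem_coinv.1 c.2
  refine (Module.Flat.lTensor_exact A hex _).1 ?_
  have hb : φ.lTensor A (Δ b) = (b : A) ⊗ₜ[ℂ] 1 := p.mem_coinv.1 b.2
  have e1 : ∀ t : (A ⊗[ℂ] A) ⊗[ℂ] A, (φ.lTensor A).lTensor A (TensorProduct.assoc ℂ A A A t) =
      TensorProduct.assoc ℂ A A H (φ.lTensor (A ⊗[ℂ] A) t) := by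
    intro t
    induction t using TensorProduct.induction_on with
    | zero => simp
    | add x y hx hy => simp only [map_add, hx, hy]
    | tmul x y =>
      induction x using TensorProduct.induction_on with
      | zero => simp
      | add x z hx hz => simp only [TensorProduct.add_tmul, map_add, hx, hz]
      | tmul x z => simp
  have e2 : ∀ t : A ⊗[ℂ] A, φ.lTensor (A ⊗[ℂ] A) (Δ.rTensor A t) =
      Δ.rTensor H (φ.lTensor A t) := by
    intro t
    rw [← LinearMap.comp_apply, ← LinearMap.comp_apply, LinearMap.lTensor_comp_rTensor,
      LinearMap.rTensor_comp_lTensor]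
  have e3 : ∀ t : A ⊗[ℂ] A, j.lTensor A t = TensorProduct.assoc ℂ A A H (t ⊗ₜ[ℂ] 1) := by
    intro t
    induction t using TensorProduct.induction_on with
    | zero => simp
    | add x y hx hy => simp only [TensorProduct.add_tmul, map_add, hx, hy]
    | tmul x y => simp [j]
  change (φ.lTensor A ∘ₗ Δ - j).lTensor A (Δ b) = 0
  rw [LinearMap.lTensor_sub, LinearMap.sub_apply, LinearMap.lTensor_comp, LinearMap.comp_apply,
    ← Coalgebra.coassoc_apply (R := ℂ) (b : A), e1, e2, hb, e3, LinearMap.rTensor_tmul, sub_self]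

/-- The left `A`-coaction on `B`, the restriction of the coproduct. -/
def coaction : Coaction A p.coinv :=
  (Coaction.self A).restrict p.incl p.incl_injective p.stable

/-- `B⁺ = B ∩ ker ε`. -/
def augIdeal : Submodule ℂ p.coinv :=
  LinearMap.ker ((Coalgebra.counit (R := ℂ) (A := A)) ∘ₗ p.incl)

instance : Module (p.coinv)ᵐᵒᵖ A := Module.compHom A (RingHom.op p.coinv.subtype.toRingHom)

/-- `B = A^{co H}` is a quantum homogeneous space: `A` is faithfully flat as a right `B`-module. -/
def IsQuantumHomogeneousSpace : Prop := RightFaithfullyFlat p.coinv A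

end HopfSurj

end QHS

end

/-! Everything reduces to showing that `Ω^(1,0)` and `Ω^(0,1)` are isotropic for `( , )`. The metric
identifies `Ω¹` with its left dual and reality gives `(v*, w*)* = (w, v)` (`Metric.star_val`), so
the Hermitian metric on `Ω¹` is formal. Since `*` exchanges the two summands, isotropy kills the
cross terms of `𝓗` and makes its restriction to each summand nondegenerate.

Write `E`, `F` for the two simple summands of `M = Ω¹`. If `F` were not isotropic, `( , )` would
give a nonzero morphism from `F` to its left dual. A covariant inner product coming from the compact
quantum group `H` identifies that dual with the conjugate of `F`, which is `E` by `*`; this would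
contradict `E ≇ F`. The proof carries this out inside `M`, without forming dual objects.

Choose a functional `φ` on `M / B⁺M` that vanishes on `F` but not on `E`. The map `m ↦ π(m₍₋₁₎)
φ(m₍₀₎)` is colinear from `M / B⁺M` to `H` with finite-dimensional image, and the image embeds in a
unitary corepresentation `w` because the orthogonal complement of a subcorepresentation is again one
(`IsUnitaryCorep.exists_section`). With the resulting functionals `Rᵢ` and `rᵢ(m) = m₍₋₁₎ Rᵢ(m₍₀₎)`,
the sum `β(m, n) = ∑ rᵢ(m) rᵢ(n*)*` lies in `B` by unitarity, is bilinear, balanced and covariant,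
and satisfies `ε(β(m, m*)) = ∑ |Rᵢ(m)|²` (`exists_covariant_form`).

By nondegeneracy `β(m, n) = (m, θ(n))` for an endomorphism `θ` of `M` (`exists_endomorphism`). Its
component `F → E` is zero: otherwise it is onto by simplicity, and composing it twice with `*` gives
a surjective endomorphism of `F`, which is injective by a finite-dimensionality argument
(`injective_of_surjective_endomorphism`), so `E ≅ F`. Hence `θ` maps `F` to `F`; positivity makes
this map nonzero, so it is onto by simplicity. Therefore `(F, F) = (F, θ(F)) = β(F, F) = 0`, as `β`
vanishes when its first argument lies in `F`. Exchanging `E` and `F` gives the other half. -/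

noncomputable section

namespace QHS

/-! ### Coefficients of a comodule -/

section Coefficient

variable {A : Type u} [Ring A] [HopfAlgebra ℂ A]
variable {M : Type u} [AddCommGroup M] [Module ℂ M]
variable {N : Type u} [AddCommGroup N] [Module ℂ N]

/-- The map `m ↦ m₍₋₁₎ φ(m₍₀₎)` attached to a functional `φ` on a comodule. -/
def Coaction.coef (ρ : Coaction A M) (φ : M →ₗ[ℂ] ℂ) : M →ₗ[ℂ] A :=
  (TensorProduct.rid ℂ A).toLinearMap ∘ₗ φ.lTensor A ∘ₗ ρ.toLin

theorem Coaction.coef_apply (ρ : Coaction A M) (φ : M →ₗ[ℂ] ℂ) (m : M) :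
    ρ.coef φ m = TensorProduct.rid ℂ A (φ.lTensor A (ρ.toLin m)) := rfl

/-- Coassociativity makes `ρ.coef φ` a colinear map `M → A`. Together with `counit_coef`, which
recovers `φ`, this is the Frobenius correspondence between functionals on `M` and colinear maps `M →
A`. -/
theorem Coaction.comul_coef (ρ : Coaction A M) (φ : M →ₗ[ℂ] ℂ) (m : M) :
    Coalgebra.comul (R := ℂ) (ρ.coef φ m) = (ρ.coef φ).lTensor A (ρ.toLin m) := by
  have h := LinearMap.congr_fun ρ.coassoc m
  simp only [LinearMap.comp_apply, LinearEquiv.coe_coe] at h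
  have e1 : ∀ X : A ⊗[ℂ] M, Coalgebra.comul (R := ℂ) (TensorProduct.rid ℂ A (φ.lTensor A X)) =
      ((TensorProduct.rid ℂ A).toLinearMap ∘ₗ φ.lTensor A).lTensor A
        (TensorProduct.assoc ℂ A A M ((Coalgebra.comul (R := ℂ) (A := A)).rTensor M X)) := by
    intro X
    induction X using TensorProduct.induction_on with
    | zero => simp
    | add X Y hX hY => simp only [map_add, hX, hY]
    | tmul a m =>
      rw [LinearMap.rTensor_tmul, LinearMap.lTensor_tmul, TensorProduct.rid_tmul, map_smul]
      generalize Coalgebra.comul (R := ℂ) a = Z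
      induction Z using TensorProduct.induction_on with
      | zero => simp
      | add X Y hX hY => simp only [map_add, smul_add, hX, hY, TensorProduct.add_tmul]
      | tmul a b => simp
  rw [ρ.coef_apply, e1, h, ← LinearMap.comp_apply, ← LinearMap.lTensor_comp]
  rfl

theorem Coaction.counit_coef (ρ : Coaction A M) (φ : M →ₗ[ℂ] ℂ) (m : M) :
    Coalgebra.counit (R := ℂ) (ρ.coef φ m) = φ m := by
  have h := LinearMap.congr_fun ρ.counit m
  have e : ∀ X : A ⊗[ℂ] M, Coalgebra.counit (R := ℂ) (TensorProduct.rid ℂ A (φ.lTensor A X)) =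
      φ (TensorProduct.lid ℂ M ((Coalgebra.counit (R := ℂ) (A := A)).rTensor M X)) := by
    intro X
    induction X using TensorProduct.induction_on with
    | zero => simp
    | add X Y hX hY => simp only [map_add, hX, hY]
    | tmul a m => simp [mul_comm]
  rw [LinearMap.comp_apply] at h
  rw [ρ.coef_apply, e, h]
  simp

theorem Coaction.coef_comp {ρM : Coaction A M} {ρN : Coaction A N} (f : M →ₗ[ℂ] N)
    (hf : ∀ m, ρN.toLin (f m) = f.lTensor A (ρM.toLin m)) (φ : N →ₗ[ℂ] ℂ) (m : M) :
    ρM.coef (φ ∘ₗ f) m = ρN.coef φ (f m) := by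
  rw [coef_apply, coef_apply, hf, LinearMap.lTensor_comp]
  rfl

/-- The functional `m ↦ \overline{φ(f(m))}` for a conjugate-linear map `f`. -/
def conjComp (φ : N →ₗ[ℂ] ℂ) (f : M →ₛₗ[starRingEnd ℂ] N) : M →ₗ[ℂ] ℂ where
  toFun m := star (φ (f m))
  map_add' _ _ := by simp
  map_smul' _ _ := by simp

theorem Coaction.coef_conjComp [StarRing A] [StarModule ℂ A] {ρM : Coaction A M}
    {ρN : Coaction A N} (f : M →ₛₗ[starRingEnd ℂ] N)
    (hf : ∀ m, ρN.toLin (f m) =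
      TensorProduct.map (starLinearEquiv ℂ (A := A)).toLinearMap f (ρM.toLin m))
    (φ : N →ₗ[ℂ] ℂ) (m : M) :
    ρM.coef (conjComp φ f) m = star (ρN.coef φ (f m)) := by
  rw [coef_apply, coef_apply, hf]
  generalize ρM.toLin m = X
  induction X using TensorProduct.induction_on with
  | zero => simp
  | add X Y hX hY => simp only [map_add, star_add, hX, hY]
  | tmul a m => simp [conjComp]

end Coefficient

section Counit

variable {A : Type u} [Ring A] [HopfAlgebra ℂ A] [StarRing A] [StarModule ℂ A]

/-- Since the coproduct is a `*`-map, `a ↦ \overline{ε(a*)}` is again a left counit, and counits are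
unique: applying `ε` to `ε'(a₍₁₎) a₍₂₎ = a` gives `ε'(a) = ε(a)`. -/
theorem HopfStarAlgebra.counit_star [HopfStarAlgebra A] (a : A) :
    Coalgebra.counit (R := ℂ) (star a) = star (Coalgebra.counit (R := ℂ) a) := by
  have key : ∀ X : A ⊗[ℂ] A,
      star (TensorProduct.lid ℂ A ((Coalgebra.counit (R := ℂ) (A := A)).rTensor A (star X))) =
      TensorProduct.lid ℂ A ((conjComp (Coalgebra.counit (R := ℂ) (A := A))
        (starLinearEquiv ℂ (A := A)).toLinearMap).rTensor A X) := by
    intro X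
    induction X using TensorProduct.induction_on with
    | zero => simp
    | add X Y hX hY => simp only [map_add, star_add, hX, hY]
    | tmul a m => simp [conjComp]
  have key' : ∀ (φ : A →ₗ[ℂ] ℂ) (X : A ⊗[ℂ] A),
      Coalgebra.counit (R := ℂ) (TensorProduct.lid ℂ A (φ.rTensor A X)) =
      φ (TensorProduct.rid ℂ A ((Coalgebra.counit (R := ℂ) (A := A)).lTensor A X)) := by
    intro φ X
    induction X using TensorProduct.induction_on with
    | zero => simp
    | add X Y hX hY => simp only [map_add, hX, hY]
    | tmul a m => simp [mul_comm]
  have h := key (Coalgebra.comul (R := ℂ) a)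
  rw [← HopfStarAlgebra.comul_star, Coalgebra.rTensor_counit_comul] at h
  have h2 := congrArg (Coalgebra.counit (R := ℂ)) h
  rw [key', Coalgebra.lTensor_counit_comul] at h2
  simp only [TensorProduct.lid_tmul, one_smul, star_star, TensorProduct.rid_tmul] at h2
  rw [h2]
  simp [conjComp]

end Counit

/-! ### Metrics on a bimodule -/

section Metric

variable {B : Type u} [Ring B] [Algebra ℂ B]
variable {M : Type u} [AddCommGroup M] [Module ℂ M] [Module B M] [Module Bᵐᵒᵖ M]
  [IsScalarTower ℂ B M] [IsScalarTower ℂ Bᵐᵒᵖ M] [SMulCommClass B Bᵐᵒᵖ M]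

theorem BTensor.induction_on {M N : Type u} [AddCommGroup M] [Module ℂ M] [Module Bᵐᵒᵖ M]
    [AddCommGroup N] [Module ℂ N] [Module B N] {motive : BTensor B M N → Prop}
    (t : BTensor B M N) (tmul : ∀ m n, motive (BTensor.tmul B m n))
    (add : ∀ x y, motive x → motive y → motive (x + y)) : motive t := by
  obtain ⟨t, rfl⟩ := (balanced B M N).mkQ_surjective t
  induction t using TensorProduct.induction_on with
  | zero => simpa [BTensor.tmul] using tmul 0 0
  | add x y hx hy => rw [map_add]; exact add _ _ hx hy
  | tmul m n => exact tmul m n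

namespace BilinPairing

variable (p : BilinPairing B M)

theorem val_smul_left (b : B) (x y : M) : p.val (b • x) y = b * p.val x y := p.map_smul b x y

theorem val_op_smul_right (b : B) (x y : M) : p.val x (MulOpposite.op b • y) = p.val x y * b :=
  p.map_op_smul b x y

theorem val_op_smul_left (b : B) (x y : M) :
    p.val (MulOpposite.op b • x) y = p.val x (b • y) := by
  rw [val, val, BTensor.op_smul_tmul]

@[simp] theorem val_add_left (x x' y : M) : p.val (x + x') y = p.val x y + p.val x' y := by
  simp only [← bilin_apply, map_add, LinearMap.add_apply]

@[simp] theorem val_add_right (x y y' : M) : p.val x (y + y') = p.val x y + p.val x y' := by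
  simp only [← bilin_apply, map_add]

@[simp] theorem val_zero_left (y : M) : p.val 0 y = 0 := by
  simp only [← bilin_apply, map_zero, LinearMap.zero_apply]

@[simp] theorem val_zero_right (x : M) : p.val x 0 = 0 := by
  simp only [← bilin_apply, map_zero]

theorem contractLeft_tmul (w x y : M) :
    p.contractLeft w (BTensor.tmul B x y) = p.val w x • y := rfl

theorem contractRight_tmul (w x y : M) :
    p.contractRight w (BTensor.tmul B x y) = MulOpposite.op (p.val y w) • x := rfl

/-- The map `id ⊗_B f : M ⊗_B M → M`, `x ⊗ y ↦ x f(y)`. -/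
def applyRight (f : M →ₗ[B] B) : BTensor B M M →ₗ[ℂ] M :=
  BTensor.lift B (TensorProduct.lift ((rightAct B M).compl₂ (f.restrictScalars ℂ))) <| by
    intro m b n
    simp [rightAct, mul_smul]

theorem applyRight_tmul (f : M →ₗ[B] B) (x y : M) :
    applyRight f (BTensor.tmul B x y) = MulOpposite.op (f y) • x := rfl

end BilinPairing

namespace Metric

variable (G : Metric B M)

theorem eq_zero_of_left {w : M} (h : ∀ m, G.val w m = 0) : w = 0 := by
  have e : ∀ t : BTensor B M M, G.contractLeft w t = 0 := by
    intro t
    induction t using BTensor.induction_on with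
    | tmul m n => rw [G.contractLeft_tmul, h, zero_smul]
    | add x y hx hy => rw [map_add, hx, hy, add_zero]
  rw [← G.contractLeft_g w, e]

theorem eq_zero_of_right {w : M} (h : ∀ m, G.val m w = 0) : w = 0 := by
  have e : ∀ t : BTensor B M M, G.contractRight w t = 0 := by
    intro t
    induction t using BTensor.induction_on with
    | tmul m n => rw [G.contractRight_tmul, h, MulOpposite.op_zero, zero_smul]
    | add x y hx hy => rw [map_add, hx, hy, add_zero]
  rw [← G.contractRight_g w, e]

theorem ext_right {w w' : M} (h : ∀ m, G.val m w = G.val m w') : w = w' := by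
  rw [← sub_eq_zero]
  apply G.eq_zero_of_right
  intro m
  rw [← G.bilin_apply, map_sub, G.bilin_apply, G.bilin_apply, h, sub_self]

/-- Every element of the left dual is of the form `( , y)`. -/
theorem exists_eq_val (f : M →ₗ[B] B) : ∃ y, ∀ m, f m = G.val m y := by
  -- Write `g = g¹ ⊗ g²` and take `y = g¹ f(g²)`. Then `f(m) = f((m, g¹) g²) = (m, g¹) f(g²) = (m,
  -- y)`.
  refine ⟨BilinPairing.applyRight f G.g, fun m => ?_⟩
  have e : ∀ t : BTensor B M M, f (G.contractLeft m t) =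
      G.val m (BilinPairing.applyRight f t) := by
    intro t
    induction t using BTensor.induction_on with
    | tmul x y =>
      rw [G.contractLeft_tmul, BilinPairing.applyRight_tmul, G.val_op_smul_right, map_smul,
        smul_eq_mul]
    | add x y hx hy => rw [map_add, map_add, map_add, hx, hy, G.val_add_right]
  rw [← e, G.contractLeft_g]

/-- An element of `A ⊗ M` is determined by its contractions with the pairing. -/
theorem lTensor_ext {A : Type u} [Ring A] [HopfAlgebra ℂ A] {X Y : A ⊗[ℂ] M}
    (h : ∀ m, (G.bilin m).lTensor A X = (G.bilin m).lTensor A Y) : X = Y := by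
  classical
  -- Coordinates of the `A`-factor in a basis reduce the claim to nondegeneracy of the pairing on
  -- `M`.
  let β := Module.Basis.ofVectorSpace ℂ A
  have e : ∀ (m : M) (X : A ⊗[ℂ] M) (i), TensorProduct.equivFinsuppOfBasisLeft β
      ((G.bilin m).lTensor A X) i = G.bilin m (TensorProduct.equivFinsuppOfBasisLeft β X i) := by
    intro m X i
    induction X using TensorProduct.induction_on with
    | zero => simp
    | add x y hx hy => simp only [map_add, Finsupp.add_apply, hx, hy]
    | tmul a f => simp
  apply (TensorProduct.equivFinsuppOfBasisLeft β).injective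
  ext i
  apply G.ext_right
  intro m
  rw [← G.bilin_apply, ← G.bilin_apply, ← e, ← e, h m]

variable [StarRing B] [StarModule ℂ B]

/-- The pairing `(w, v)' = (v*, w*)*` is inverse to `g†`, and `g† = g`; an inverse of `g` is unique.
The identity `e1` is this uniqueness argument: on `x ⊗ y` both sides equal `(y, w*)* (x*, v)`, and
at `t = g` the contractions disappear. -/
theorem star_val (s : BimoduleStar B M) (hs : G.IsReal s) (w v : M) :
    star (G.val (s.toLin v) (s.toLin w)) = G.val w v := by
  let val' : M → M → B := fun w v => star (G.val (s.toLin v) (s.toLin w))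
  have e1 : ∀ t : BTensor B M M, G.val (s.toLin (G.contractRight (s.toLin w) t)) v =
      val' w (G.contractRight v (s.dagger t)) := by
    intro t
    induction t using BTensor.induction_on with
    | tmul x y =>
      have : s.dagger (BTensor.tmul B x y) = BTensor.tmul B (s.toLin y) (s.toLin x) := rfl
      rw [this, G.contractRight_tmul, G.contractRight_tmul, s.map_op_smul, G.val_smul_left]
      simp only [val', s.map_op_smul, G.val_smul_left, star_mul, star_star, s.invol]
    | add x y hx hy =>
      simp only [map_add, G.val_add_left, hx, hy, val', star_add]
  have := e1 G.g
  have hs' : s.dagger G.g = G.g := hs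
  rw [hs', G.contractRight_g, G.contractRight_g, s.invol] at this
  exact this.symm

end Metric

end Metric

/-! ### Subcomodules of a compact quantum group algebra -/

section Unitary

variable {H : Type u} [Ring H] [HopfAlgebra ℂ H] [StarRing H] [StarModule ℂ H]

open Matrix

variable {I : Type} [Fintype I] [DecidableEq I] (w : Matrix I I H)

/-- `w` is a unitary matrix corepresentation. -/
structure IsUnitaryCorep : Prop where
  comul : ∀ i j, Coalgebra.comul (R := ℂ) (w i j) = ∑ k, w i k ⊗ₜ[ℂ] w k j
  star_mul : w.conjTranspose * w = 1
  mul_star : w * w.conjTranspose = 1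

variable {w}

/-- The counit axiom reads `ε(w) w = w`, and `w` is invertible. -/
theorem IsUnitaryCorep.counit (hw : IsUnitaryCorep w) (i j : I) :
    Coalgebra.counit (R := ℂ) (w i j) = (1 : Matrix I I ℂ) i j := by
  have h1 : (Matrix.of fun i j => algebraMap ℂ H (Coalgebra.counit (R := ℂ) (w i j))) * w = w := by
    ext i j
    have := Coalgebra.rTensor_counit_comul (R := ℂ) (w i j)
    rw [hw.comul] at this
    have := congrArg (TensorProduct.lid ℂ H) this
    simp only [map_sum, LinearMap.rTensor_tmul, TensorProduct.lid_tmul, one_smul] at this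
    rw [Matrix.mul_apply, ← this]
    simp [Algebra.smul_def, Matrix.of_apply]
  have h2 := congrArg (· * w.conjTranspose) h1
  simp only [mul_assoc, hw.mul_star, mul_one] at h2
  have h3 := congrArg (Coalgebra.counit (R := ℂ)) (congrFun (congrFun h2 i) j)
  simp only [Matrix.of_apply, Bialgebra.counit_algebraMap] at h3
  rw [h3, Matrix.one_apply, Matrix.one_apply]
  split_ifs <;> simp

/-- The antipode axiom makes `S(w)` a right inverse of `w`, so it coincides with the conjugate
transpose. -/
theorem IsUnitaryCorep.antipode (hw : IsUnitaryCorep w) (i j : I) :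
    HopfAlgebra.antipode ℂ (w i j) = star (w j i) := by
  have h1 : w * (Matrix.of fun i j => HopfAlgebra.antipode ℂ (w i j)) = 1 := by
    ext i j
    have := HopfAlgebra.mul_antipode_lTensor_comul_apply (R := ℂ) (w i j)
    rw [hw.comul, hw.counit] at this
    simp only [map_sum, LinearMap.lTensor_tmul, LinearMap.mul'_apply] at this
    rw [Matrix.mul_apply]
    simp only [Matrix.of_apply]
    rw [this, Matrix.one_apply, Matrix.one_apply]
    split_ifs <;> simp
  have h2 := congrArg (w.conjTranspose * ·) h1
  simp only [← mul_assoc, hw.star_mul, one_mul, mul_one] at h2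
  exact congrFun (congrFun h2 i) j

/-- The functional `h ↦ \overline{f(S(h)*)}`. -/
def adjointFunctional (f : H →ₗ[ℂ] ℂ) : H →ₗ[ℂ] ℂ where
  toFun h := star (f (star (HopfAlgebra.antipode ℂ h)))
  map_add' _ _ := by simp
  map_smul' _ _ := by simp

theorem IsUnitaryCorep.adjointFunctional_apply (hw : IsUnitaryCorep w) (f : H →ₗ[ℂ] ℂ) (i j : I) :
    adjointFunctional f (w i j) = star (f (w j i)) := by
  change star (f (star _)) = _
  rw [hw.antipode, star_star]

/-- The right action of a functional on row vectors. -/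
def rowAct (w : Matrix I I H) (f : H →ₗ[ℂ] ℂ) (y : EuclideanSpace ℂ I) : EuclideanSpace ℂ I :=
  WithLp.toLp 2 fun j => ∑ i, y i * f (w i j)

/-- The adjoint of the action of a functional is again the action of a functional. Hence orthogonal
complements of invariant subspaces are invariant. -/
theorem IsUnitaryCorep.inner_rowAct (hw : IsUnitaryCorep w) (f : H →ₗ[ℂ] ℂ)
    (n y : EuclideanSpace ℂ I) :
    inner ℂ n (rowAct w f y) = inner ℂ (rowAct w (adjointFunctional f) n) y := by
  simp only [PiLp.inner_apply, rowAct, RCLike.inner_apply, hw.adjointFunctional_apply, map_sum,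
    map_mul, Finset.sum_mul, Finset.mul_sum]
  rw [Finset.sum_comm]
  refine Finset.sum_congr rfl fun i _ => Finset.sum_congr rfl fun j _ => ?_
  simp
  ring

/-- If the span of the entries `q i` of a column is a quotient of the unitary corepresentation `w`,
then it embeds into `w`. -/
theorem IsUnitaryCorep.exists_section (hw : IsUnitaryCorep w) (q : I → H)
    (hq : ∀ i, Coalgebra.comul (R := ℂ) (q i) = ∑ j, w i j ⊗ₜ[ℂ] q j) :
    ∃ L : H →ₗ[ℂ] EuclideanSpace ℂ I, ∀ x ∈ Submodule.span ℂ (Set.range q),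
      (L x = 0 → x = 0) ∧ ∀ i, TensorProduct.rid ℂ H
        (((EuclideanSpace.proj i).toLinearMap ∘ₗ L).lTensor H (Coalgebra.comul (R := ℂ) x)) =
        ∑ j, L x j • w j i := by
  let Q : EuclideanSpace ℂ I →ₗ[ℂ] H :=
    (Fintype.linearCombination ℂ q) ∘ₗ (WithLp.linearEquiv 2 ℂ (I → ℂ)).toLinearMap
  have hQ : ∀ y, Q y = ∑ i, y i • q i := fun y => rfl
  let N := LinearMap.ker Q
  have hinj : Function.Injective (Q ∘ₗ Nᗮ.subtype) := by
    rw [← LinearMap.ker_eq_bot, LinearMap.ker_eq_bot']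
    intro y hy
    apply Subtype.ext
    have : (y : EuclideanSpace ℂ I) ∈ N ⊓ Nᗮ := ⟨hy, y.2⟩
    rwa [Submodule.inf_orthogonal_eq_bot] at this
  -- `Q` maps `Nᗮ` bijectively onto the span of the `q i`. The inverse is extended linearly to all
  -- of `H`; only its values on that span matter.
  obtain ⟨L, hL⟩ := LinearMap.exists_leftInverse_of_injective _ (LinearMap.ker_eq_bot.2 hinj)
  have hLQ : ∀ y ∈ Nᗮ, (L (Q y) : EuclideanSpace ℂ I) = y := fun y hy =>
    congrArg Subtype.val (LinearMap.congr_fun hL ⟨y, hy⟩)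
  have hcomul : ∀ y, Coalgebra.comul (R := ℂ) (Q y) = ∑ i, ∑ j, y i • (w i j ⊗ₜ[ℂ] q j) := by
    intro y
    simp only [hQ, map_sum, map_smul, hq, Finset.smul_sum]
  have hact : ∀ (f : H →ₗ[ℂ] ℂ) y, Q (rowAct w f y) =
      TensorProduct.lid ℂ H (f.rTensor H (Coalgebra.comul (R := ℂ) (Q y))) := by
    intro f y
    rw [hcomul]
    simp only [map_sum, map_smul, LinearMap.rTensor_tmul, TensorProduct.lid_tmul, hQ, rowAct,
      Finset.sum_smul, mul_smul]
    rw [Finset.sum_comm]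
  -- By `hact`, `Q` intertwines the row action with the action of functionals on `H` through the
  -- coproduct, so its kernel is invariant.
  have hN : ∀ (f : H →ₗ[ℂ] ℂ) n, n ∈ N → rowAct w f n ∈ N := by
    intro f n hn
    have hn : Q n = 0 := hn
    change Q _ = 0
    rw [hact, hn]
    simp
  have hNo : ∀ (f : H →ₗ[ℂ] ℂ) y, y ∈ Nᗮ → rowAct w f y ∈ Nᗮ := by
    intro f y hy
    rw [Submodule.mem_orthogonal]
    intro n hn
    rw [hw.inner_rowAct]
    exact (Submodule.mem_orthogonal _ _).1 hy _ (hN _ _ hn)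
  refine ⟨Nᗮ.subtype ∘ₗ L, fun x hx => ?_⟩
  obtain ⟨y, hy, rfl⟩ : ∃ y ∈ Nᗮ, Q y = x := by
    rw [← Fintype.range_linearCombination] at hx
    obtain ⟨z, rfl⟩ := hx
    obtain ⟨n, hn, y, hy, hz⟩ := Submodule.exists_add_mem_mem_orthogonal (K := N) (WithLp.toLp 2 z)
    refine ⟨y, hy, ?_⟩
    have : Q (WithLp.toLp 2 z) = Q y := by
      rw [hz, map_add, show Q n = 0 from hn, zero_add]
    exact this.symm
  have hy' : (Nᗮ.subtype ∘ₗ L) (Q y) = y := hLQ y hy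
  refine ⟨fun h => ?_, fun i => ?_⟩
  · rw [hy'] at h
    rw [h, map_zero]
  · rw [hy']
    -- Tested against a functional `f`, colinearity of `L` at `Q y` says that `L` inverts `Q` at
    -- `rowAct w f y`, which lies in `Nᗮ` by `hNo`.
    rw [← sub_eq_zero, ← Module.forall_dual_apply_eq_zero_iff ℂ]
    intro f
    have e : ∀ X : H ⊗[ℂ] H, f (TensorProduct.rid ℂ H
        (((EuclideanSpace.proj i).toLinearMap ∘ₗ Nᗮ.subtype ∘ₗ L).lTensor H X)) =
        (L (TensorProduct.lid ℂ H (f.rTensor H X)) : EuclideanSpace ℂ I) i := by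
      intro X
      induction X using TensorProduct.induction_on with
      | zero => simp
      | add X Y hX hY => simp only [map_add, hX, hY, Submodule.coe_add, PiLp.add_apply]
      | tmul a b => simp [mul_comm]
    rw [map_sub, e, ← hact, hLQ _ (hNo _ _ hy), sub_eq_zero]
    simp [rowAct]

/-- Finitely many unitary coefficients span a space containing `X`. Each lies in a column of its
corepresentation, and the coproduct of a column is a quotient of that corepresentation, so
`exists_section` applies to the block-diagonal sum. `X` itself need not be a subcomodule. -/
theorem IsCQGAlgebra.exists_unitary (hH : IsCQGAlgebra H) (X : Submodule ℂ H)
    [FiniteDimensional ℂ X] :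
    ∃ (I : Type) (_ : Fintype I) (_ : DecidableEq I) (w : Matrix I I H), IsUnitaryCorep w ∧
    ∃ L : H →ₗ[ℂ] EuclideanSpace ℂ I, ∀ x ∈ X,
      (L x = 0 → x = 0) ∧ ∀ i, TensorProduct.rid ℂ H
        (((EuclideanSpace.proj i).toLinearMap ∘ₗ L).lTensor H (Coalgebra.comul (R := ℂ) x)) =
        ∑ j, L x j • w j i := by
  classical
  obtain ⟨T, hT, hXT⟩ : ∃ T : Finset H, (T : Set H) ⊆ {h : H | ∃ (n : ℕ)
      (v : Matrix (Fin n) (Fin n) H),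
      (∀ i j, Coalgebra.comul (R := ℂ) (v i j) = ∑ k, v i k ⊗ₜ[ℂ] v k j) ∧
      v.conjTranspose * v = 1 ∧ v * v.conjTranspose = 1 ∧ ∃ i j, v i j = h} ∧
      X ≤ Submodule.span ℂ (T : Set H) := by
    have hfg : X.FG := Module.Finite.iff_fg.1 inferInstance
    obtain ⟨s, rfl⟩ := hfg
    have : ∀ x ∈ s, x ∈ Submodule.span ℂ _ := fun x _ => hH.2.ge (Submodule.mem_top (x := x))
    choose! t ht ht' using fun x hx => Submodule.mem_span_finite_of_mem_span (this x hx)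
    refine ⟨s.biUnion t, ?_, ?_⟩
    · simpa using ht
    · refine Submodule.span_le.2 fun x hx => ?_
      exact Submodule.span_mono (Finset.coe_subset.2 (Finset.subset_biUnion_of_mem t hx)) (ht' x hx)
  obtain ⟨m, e⟩ : ∃ m, Nonempty (Fin m ≃ T) := ⟨_, ⟨(Fintype.equivFin T).symm⟩⟩
  obtain ⟨e⟩ := e
  choose n v hv1 hv2 hv3 i0 j0 hij using fun k : Fin m => hT (e k).2
  let w := Matrix.blockDiagonal' v
  have hw : IsUnitaryCorep w := by
    refine ⟨?_, ?_, ?_⟩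
    · rintro ⟨k, i⟩ ⟨l, j⟩
      rw [Fintype.sum_sigma]
      rw [Finset.sum_eq_single k]
      · by_cases hkl : k = l
        · subst hkl
          simp only [w, Matrix.blockDiagonal'_apply_eq]
          exact hv1 k i j
        · simp [w, Matrix.blockDiagonal'_apply_ne _ _ _ hkl]
      · intro b _ hb
        refine Finset.sum_eq_zero fun c _ => ?_
        simp only [w]
        rw [Matrix.blockDiagonal'_apply_ne _ _ _ hb.symm, TensorProduct.zero_tmul]
      · simp
    · rw [Matrix.blockDiagonal'_conjTranspose, ← Matrix.blockDiagonal'_mul]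
      simp only [hv2]
      exact Matrix.blockDiagonal'_one
    · rw [Matrix.blockDiagonal'_conjTranspose, ← Matrix.blockDiagonal'_mul]
      simp only [hv3]
      exact Matrix.blockDiagonal'_one
  -- From the `k`-th block take the whole column through the chosen coefficient `v k (i0 k) (j0 k)`:
  -- a column, unlike a single entry, is closed under the coproduct.
  let q : (Σ k : Fin m, Fin (n k)) → H := fun x => v x.1 x.2 (j0 x.1)
  obtain ⟨L, hL⟩ := hw.exists_section q (by
    rintro ⟨k, i⟩
    rw [Fintype.sum_sigma, Finset.sum_eq_single k]
    · simp only [w, Matrix.blockDiagonal'_apply_eq]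
      exact hv1 k i _
    · intro b _ hb
      refine Finset.sum_eq_zero fun c _ => ?_
      simp only [w]
      rw [Matrix.blockDiagonal'_apply_ne _ _ _ hb.symm, TensorProduct.zero_tmul]
    · simp)
  refine ⟨_, inferInstance, inferInstance, w, hw, L, fun x hx => hL x ?_⟩
  refine Submodule.span_mono ?_ (hXT hx)
  intro h hh
  refine ⟨⟨e.symm ⟨h, hh⟩, i0 _⟩, ?_⟩
  have := hij (e.symm ⟨h, hh⟩)
  simpa [q] using this

end Unitary

/-! ### Covariant bilinear maps -/

section CovariantBilinear

variable {A : Type u} [Ring A] [HopfAlgebra ℂ A]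
variable {B : Type u} [AddCommGroup B] [Module ℂ B]
variable {M : Type u} [AddCommGroup M] [Module ℂ M]
variable {N : Type u} [AddCommGroup N] [Module ℂ N]

/-- The bilinear map `β` is colinear: `β(m, n)₍₋₁₎ ⊗ β(m, n)₍₀₎ = m₍₋₁₎ n₍₋₁₎ ⊗ β(m₍₀₎, n₍₀₎)`. -/
def IsCovariantBilinear (ρB : Coaction A B) (ρM : Coaction A M) (ρN : Coaction A N)
    (β : M →ₗ[ℂ] N →ₗ[ℂ] B) : Prop :=
  ∀ m n, ρB.toLin (β m n) =
    TensorProduct.map₂ (LinearMap.mul ℂ A) β (ρM.toLin m) (ρN.toLin n)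

/-- `S(m₍₋₁₎) β(m₍₀₎, n)₍₋₁₎ ⊗ β(m₍₀₎, n)₍₀₎ = n₍₋₁₎ ⊗ β(m, n₍₀₎)`. -/
theorem IsCovariantBilinear.antipode_mul {ρB : Coaction A B} {ρM : Coaction A M}
    {ρN : Coaction A N} {β : M →ₗ[ℂ] N →ₗ[ℂ] B} (h : IsCovariantBilinear ρB ρM ρN β)
    (m : M) (n : N) :
    (LinearMap.mul' ℂ A).rTensor B ((TensorProduct.assoc ℂ A A B).symm
      (TensorProduct.map (HopfAlgebra.antipode ℂ) (ρB.toLin ∘ₗ β.flip n) (ρM.toLin m))) =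
    (β m).lTensor A (ρN.toLin n) := by
  -- Covariance turns the left side into `S(m₍₋₂₎) m₍₋₁₎ n₍₋₁₎ ⊗ β(m₍₀₎, n₍₀₎)`, where the antipode
  -- axiom cancels the `m`-legs.
  have e0 : ρB.toLin ∘ₗ β.flip n =
      (TensorProduct.map₂ (LinearMap.mul ℂ A) β).flip (ρN.toLin n) ∘ₗ ρM.toLin :=
    LinearMap.ext fun m => h m n
  rw [e0]
  generalize ρN.toLin n = Y
  induction Y using TensorProduct.induction_on with
  | zero => simp
  | add X Y hX hY =>
    simp only [map_add, LinearMap.add_comp, TensorProduct.map_add_right, LinearMap.add_apply,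
      hX, hY]
  | tmul y n =>
    have e1 : ∀ X : A ⊗[ℂ] M, (LinearMap.mul' ℂ A).rTensor B ((TensorProduct.assoc ℂ A A B).symm
        (TensorProduct.map (HopfAlgebra.antipode ℂ)
          ((TensorProduct.map₂ (LinearMap.mul ℂ A) β).flip (y ⊗ₜ[ℂ] n))
          (TensorProduct.assoc ℂ A A M ((Coalgebra.comul (R := ℂ) (A := A)).rTensor M X)))) =
        y ⊗ₜ[ℂ] β (TensorProduct.lid ℂ M
          ((Coalgebra.counit (R := ℂ) (A := A)).rTensor M X)) n := by
      intro X
      induction X using TensorProduct.induction_on with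
      | zero => simp
      | add X Y hX hY => simp only [map_add, LinearMap.add_apply, TensorProduct.tmul_add, hX, hY]
      | tmul a m =>
        have e2 : ∀ Z : A ⊗[ℂ] A, (LinearMap.mul' ℂ A).rTensor B
            ((TensorProduct.assoc ℂ A A B).symm
            (TensorProduct.map (HopfAlgebra.antipode ℂ)
              ((TensorProduct.map₂ (LinearMap.mul ℂ A) β).flip (y ⊗ₜ[ℂ] n))
              (TensorProduct.assoc ℂ A A M (Z ⊗ₜ[ℂ] m)))) =
            (LinearMap.mul' ℂ A ((HopfAlgebra.antipode ℂ).rTensor A Z) * y) ⊗ₜ[ℂ] β m n := by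
          intro Z
          induction Z using TensorProduct.induction_on with
          | zero => simp
          | add X Y hX hY => simp only [map_add, TensorProduct.add_tmul, add_mul, hX, hY]
          | tmul a b => simp [mul_assoc]
        rw [LinearMap.rTensor_tmul, e2, HopfAlgebra.mul_antipode_rTensor_comul_apply]
        simp [Algebra.algebraMap_eq_smul_one, TensorProduct.smul_tmul]
    have h1 := LinearMap.congr_fun ρM.coassoc m
    have h2 := LinearMap.congr_fun ρM.counit m
    simp only [LinearMap.comp_apply, LinearEquiv.coe_coe] at h1 h2
    have h3 := e1 (ρM.toLin m)
    rw [h1, h2] at h3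
    change _ = y ⊗ₜ[ℂ] β m n
    simpa using h3

end CovariantBilinear

/-! ### Functionals on `M / B⁺M` and their coefficient maps to `A`. -/

section Quantum

variable {A H : Type u} [Ring A] [HopfAlgebra ℂ A] [StarRing A] [StarModule ℂ A]
  [Ring H] [HopfAlgebra ℂ H] [StarRing H] [StarModule ℂ H] [HopfStarAlgebra A]
  (p : HopfSurj A H)

namespace HopfSurj

/-- The restriction of the counit to `B`. -/
def counit : p.coinv →ₗ[ℂ] ℂ := Coalgebra.counit (R := ℂ) (A := A) ∘ₗ p.incl

theorem incl_lTensor_coaction (b : p.coinv) :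
    p.incl.lTensor A (p.coaction.toLin b) = Coalgebra.comul (R := ℂ) (p.incl b) :=
  (Coaction.self A).lTensor_restrictLin p.incl p.incl_injective p.stable b

theorem coaction_coef_counit (b : p.coinv) :
    TensorProduct.rid ℂ A (p.counit.lTensor A (p.coaction.toLin b)) = p.incl b := by
  rw [counit, LinearMap.lTensor_comp, LinearMap.comp_apply, incl_lTensor_coaction,
    Coalgebra.lTensor_counit_comul]
  simp

theorem rightCoact_apply (a : A) : p.rightCoact a =
    (p.π : A →ₐ[ℂ] H).toLinearMap.lTensor A (Coalgebra.comul (R := ℂ) a) := rfl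

theorem rightCoact_star (a : A) : p.rightCoact (star a) = star (p.rightCoact a) := by
  have e : ∀ t : A ⊗[ℂ] A,
      Algebra.TensorProduct.map (AlgHom.id ℂ A) (p.π : A →ₐ[ℂ] H) (star t) =
      star (Algebra.TensorProduct.map (AlgHom.id ℂ A) (p.π : A →ₐ[ℂ] H) t) := by
    intro t
    induction t using TensorProduct.induction_on with
    | zero => simp
    | add x y hx hy => simp only [star_add, map_add, hx, hy]
    | tmul x y => simp [p.map_star]
  simp only [rightCoact, AlgHom.comp_apply, Bialgebra.comulAlgHom_apply,
    HopfStarAlgebra.comul_star, e]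

/-- Apply `ε ⊗ id` to the coinvariance equation. It follows that `B` acts through `ε` after
composing with `π`, which is how maps to `H` factor over `M / B⁺M`. -/
theorem π_incl (b : p.coinv) : p.π (p.incl b) = p.counit b • (1 : H) := by
  have e : ∀ t : A ⊗[ℂ] A, TensorProduct.lid ℂ H ((Coalgebra.counit (R := ℂ) (A := A)).rTensor H
      ((p.π : A →ₐ[ℂ] H).toLinearMap.lTensor A t)) =
      p.π (TensorProduct.lid ℂ A ((Coalgebra.counit (R := ℂ) (A := A)).rTensor A t)) := by
    intro t
    induction t using TensorProduct.induction_on with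
    | zero => simp
    | add x y hx hy => simp only [map_add, hx, hy]
    | tmul x y => simp
  have h := e (Coalgebra.comul (R := ℂ) (p.incl b))
  have hb : (p.π : A →ₐ[ℂ] H).toLinearMap.lTensor A (Coalgebra.comul (R := ℂ) (p.incl b)) =
    p.incl b ⊗ₜ[ℂ] 1 := p.mem_coinv.1 b.2
  rw [Coalgebra.rTensor_counit_comul, hb] at h
  simp only [LinearMap.rTensor_tmul, TensorProduct.lid_tmul, one_smul] at h
  exact h.symm

theorem comul_π (a : A) : Coalgebra.comul (R := ℂ) (p.π a) =
    TensorProduct.map (p.π : A →ₐ[ℂ] H).toLinearMap (p.π : A →ₐ[ℂ] H).toLinearMap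
      (Coalgebra.comul (R := ℂ) a) :=
  (CoalgHomClass.map_comp_comul_apply p.π a).symm

end HopfSurj

variable {M : Type u} [AddCommGroup M] [Module ℂ M] [Module p.coinv M] [Module p.coinvᵐᵒᵖ M]
  [IsScalarTower ℂ p.coinv M] [IsScalarTower ℂ p.coinvᵐᵒᵖ M] [SMulCommClass p.coinv p.coinvᵐᵒᵖ M]

variable {p}

/-- The hypothesis `hφ` says that `φ` lives on `M / B⁺M`; the claim is then `b₍₁₎ ε(b₍₂₎) = b`. -/
theorem IsRelHopf.coef_smul {ρ : Coaction A M} (hM : IsRelHopf p.coaction ρ) (φ : M →ₗ[ℂ] ℂ)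
    (hφ : ∀ (b : p.coinv) m, φ (b • m) = p.counit b * φ m) (b : p.coinv) (m : M) :
    ρ.coef φ (b • m) = p.incl b * ρ.coef φ m := by
  rw [← p.coaction_coef_counit, ρ.coef_apply, ρ.coef_apply, hM.smul]
  generalize p.coaction.toLin b = X
  generalize ρ.toLin m = Y
  induction X using TensorProduct.induction_on with
  | zero => simp
  | add X X' h h' => simp only [map_add, LinearMap.add_apply, add_mul, h, h']
  | tmul a b =>
    induction Y using TensorProduct.induction_on with
    | zero => simp
    | add X X' h h' => simp only [map_add, mul_add, h, h']
    | tmul a' m => simp [leftAct, hφ, smul_smul, mul_comm]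

theorem IsRelHopf.coef_op_smul {ρ : Coaction A M} (hM : IsRelHopf p.coaction ρ) (φ : M →ₗ[ℂ] ℂ)
    (hφ : ∀ (b : p.coinv) m, φ (MulOpposite.op b • m) = p.counit b * φ m) (b : p.coinv) (m : M) :
    ρ.coef φ (MulOpposite.op b • m) = ρ.coef φ m * p.incl b := by
  rw [← p.coaction_coef_counit, ρ.coef_apply, ρ.coef_apply, hM.op_smul]
  generalize p.coaction.toLin b = X
  generalize ρ.toLin m = Y
  induction X using TensorProduct.induction_on with
  | zero => simp
  | add X X' h h' => simp only [map_add, mul_add, h, h']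
  | tmul a b =>
    induction Y using TensorProduct.induction_on with
    | zero => simp
    | add X X' h h' => simp only [map_add, LinearMap.add_apply, add_mul, h, h']
    | tmul a' m => simp [rightAct, hφ, smul_smul, mul_comm]

/-- As `B` acts on the values through scalars, the images of module generators span the range over
`ℂ`. -/
theorem finiteDimensional_range [Module.Finite p.coinv M] {V : Type u} [AddCommGroup V]
    [Module ℂ V] (f : M →ₗ[ℂ] V)
    (hf : ∀ (b : p.coinv) m, f (b • m) = p.counit b • f m) :
    FiniteDimensional ℂ (LinearMap.range f) := by
  classical
  obtain ⟨s, hs⟩ := Module.Finite.fg_top (R := p.coinv) (M := M)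
  have : LinearMap.range f ≤ Submodule.span ℂ ((s.image f : Finset V) : Set V) := by
    rintro _ ⟨m, rfl⟩
    have hm : m ∈ Submodule.span p.coinv (s : Set M) := hs ▸ Submodule.mem_top
    induction hm using Submodule.span_induction with
    | mem x hx => exact Submodule.subset_span (by simpa using ⟨x, hx, rfl⟩)
    | zero => simp
    | add x y _ _ hx hy => rw [map_add]; exact add_mem hx hy
    | smul b x _ hx => rw [hf]; exact Submodule.smul_mem _ _ hx
  exact Submodule.finiteDimensional_of_le this

/-- Functionals that vanish on `B⁺ M` vanish on `M B⁺`. -/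
theorem IsModzObject.map_op_smul (h : IsModzObject p.augIdeal M) {φ : M →ₗ[ℂ] ℂ}
    (hφ : ∀ (b : p.coinv) m, φ (b • m) = p.counit b * φ m) (b : p.coinv) (m : M) :
    φ (MulOpposite.op b • m) = p.counit b * φ m := by
  have h1 : ∀ x ∈ Submodule.span ℂ {x : M | ∃ b ∈ p.augIdeal, ∃ m : M,
      x = MulOpposite.op b • m}, φ x = 0 := by
    rw [h.comm]
    intro x hx
    have : Submodule.span ℂ {x : M | ∃ b ∈ p.augIdeal, ∃ m : M, x = b • m} ≤ LinearMap.ker φ := by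
      refine Submodule.span_le.2 ?_
      rintro _ ⟨b, hb, m, rfl⟩
      have hb : p.counit b = 0 := hb
      change φ _ = 0
      rw [hφ, hb, zero_mul]
    exact this hx
  -- `B = ℂ1 ⊕ B⁺`, so vanishing on `M B⁺` is equivalent to `B` acting through `ε` from the right.
  have hb : b - p.counit b • (1 : p.coinv) ∈ p.augIdeal := by
    change p.counit _ = 0
    have h1 : p.counit 1 = 1 := Bialgebra.counit_one (R := ℂ) (A := A)
    rw [map_sub, map_smul, h1]
    simp
  have := h1 _ (Submodule.subset_span ⟨_, hb, m, rfl⟩)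
  rw [MulOpposite.op_sub, sub_smul, map_sub, sub_eq_zero, MulOpposite.op_smul, smul_assoc,
    MulOpposite.op_one, one_smul, φ.map_smul (p.counit b) m] at this
  exact this

namespace Metric

variable (G : Metric p.coinv M) {ρ : Coaction A M} {hM : IsRelHopf p.coaction ρ}

theorem IsCovariant.isCovariantBilinear {G : Metric p.coinv M} (hG : G.IsCovariant hM) :
    IsCovariantBilinear p.coaction ρ ρ G.bilin := by
  intro m n
  have h := hG.pairing (BTensor.tmul p.coinv m n)
  have e : tensorCoact hM hM (BTensor.tmul p.coinv m n) = TensorProduct.map₂ (LinearMap.mul ℂ A)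
    (BTensor.mkBilin p.coinv M M) (ρ.toLin m) (ρ.toLin n) := rfl
  rw [e] at h
  rw [G.bilin_apply, BilinPairing.val, h]
  generalize ρ.toLin m = X
  generalize ρ.toLin n = Y
  induction X using TensorProduct.induction_on with
  | zero => simp
  | add X X' h h' => simp only [map_add, LinearMap.add_apply, h, h']
  | tmul a b =>
    induction Y using TensorProduct.induction_on with
    | zero => simp
    | add X X' h h' => simp only [map_add, h, h']
    | tmul a' m => simp [BilinPairing.bilin]

/-- The functional `ε(( , n))`. -/
def aug (n : M) : M →ₗ[ℂ] ℂ := p.counit ∘ₗ G.bilin.flip n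

theorem aug_apply (m n : M) : G.aug n m = p.counit (G.val m n) := rfl

theorem aug_smul (n : M) (b : p.coinv) (m : M) : G.aug n (b • m) = p.counit b * G.aug n m := by
  rw [aug_apply, G.val_smul_left]
  exact Bialgebra.counit_mul (R := ℂ) (A := A) (p.incl b) (p.incl _)

/-- Covariance and `b = b₍₁₎ ε(b₍₂₎)` give `(m, n) = m₍₋₁₎ n₍₋₁₎ ε((m₍₀₎, n₍₀₎))`, so the
coefficients of `m` determine all `(m, n)`. In effect the metric shows that `M → A ⊗ M / B⁺M` is
injective. -/
theorem eq_zero_of_coef_aug {G : Metric p.coinv M} (hG : G.IsCovariant hM) {m : M}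
    (h : ∀ n, ρ.coef (G.aug n) m = 0) : m = 0 := by
  apply G.eq_zero_of_left
  intro n
  apply p.incl_injective
  rw [map_zero, ← p.coaction_coef_counit, ← G.bilin_apply, hG.isCovariantBilinear]
  generalize ρ.toLin n = Y
  induction Y using TensorProduct.induction_on with
  | zero => simp
  | add X X' h h' => simp only [map_add, h, h', add_zero]
  | tmul a n =>
    have e : ∀ X : A ⊗[ℂ] M, TensorProduct.rid ℂ A (p.counit.lTensor A
        (TensorProduct.map₂ (LinearMap.mul ℂ A) G.bilin X (a ⊗ₜ[ℂ] n))) =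
        TensorProduct.rid ℂ A ((G.aug n).lTensor A X) * a := by
      intro X
      induction X using TensorProduct.induction_on with
      | zero => simp
      | add X X' h h' => simp only [map_add, LinearMap.add_apply, add_mul, h, h']
      | tmul a' m => simp [aug]
    rw [e, ← ρ.coef_apply, h, zero_mul]

end Metric

/-- Surjective colinear endomorphisms of a finitely generated subobject of a relative Hopf module
with a metric are injective. -/
theorem injective_of_surjective_endomorphism {ρ : Coaction A M} {hM : IsRelHopf p.coaction ρ}
    {G : Metric p.coinv M} (hG : G.IsCovariant hM)
    {F : Type u} [AddCommGroup F] [Module ℂ F] [Module p.coinv F] [IsScalarTower ℂ p.coinv F]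
    [Module.Finite p.coinv F] {ρF : Coaction A F} (j : F →ₗ[p.coinv] M)
    (hj : Function.Injective j) (hjρ : ∀ f, ρ.toLin (j f) =
      (j.restrictScalars ℂ).lTensor A (ρF.toLin f))
    (P : F →ₗ[p.coinv] F) (hP : ∀ f, ρF.toLin (P f) =
      (P.restrictScalars ℂ).lTensor A (ρF.toLin f)) (hPs : Function.Surjective P) :
    Function.Injective P := by
  -- `W` is the dual of `F / B⁺F`. It is finite-dimensional because such functionals are determined
  -- by their values on generators, so the transpose of `P` on `W`, injective as `P` is onto, is
  -- also onto.
  let W : Submodule ℂ (F →ₗ[ℂ] ℂ) :=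
    { carrier := {φ | ∀ (b : p.coinv) f, φ (b • f) = p.counit b * φ f}
      add_mem' := fun {φ ψ} hφ hψ b f => by
        simp only [LinearMap.add_apply, hφ b f, hψ b f, mul_add]
      zero_mem' := fun b f => by simp
      smul_mem' := fun c φ hφ b f => by
        simp only [LinearMap.smul_apply, hφ b f, smul_eq_mul]; ring }
  have hW : FiniteDimensional ℂ W := by
    obtain ⟨s, hs⟩ := Module.Finite.fg_top (R := p.coinv) (M := F)
    let ev : W →ₗ[ℂ] (s → ℂ) :=
      { toFun := fun φ x => φ.1 x
        map_add' := fun _ _ => rfl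
        map_smul' := fun _ _ => rfl }
    refine Module.Finite.of_injective ev ?_
    rw [← LinearMap.ker_eq_bot, LinearMap.ker_eq_bot']
    intro φ h
    apply Subtype.ext
    ext f
    have hf : f ∈ Submodule.span p.coinv (s : Set F) := hs ▸ Submodule.mem_top
    induction hf using Submodule.span_induction with
    | mem x hx => exact congrFun h ⟨x, hx⟩
    | zero => simp
    | add x y _ _ hx hy => simp only [map_add, hx, hy]
    | smul b x _ hx => rw [φ.2 b x, hx]; simp
  let Pt : W →ₗ[ℂ] W :=
    { toFun := fun φ => ⟨φ.1 ∘ₗ P.restrictScalars ℂ, fun b f => by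
        have := φ.2 b (P f)
        simpa using this⟩
      map_add' := fun _ _ => rfl
      map_smul' := fun _ _ => rfl }
  have hPt : Function.Injective Pt := by
    intro φ ψ h
    apply Subtype.ext
    ext f
    obtain ⟨f, rfl⟩ := hPs f
    exact LinearMap.congr_fun (congrArg Subtype.val h) f
  have hPt' : Function.Surjective Pt := LinearMap.injective_iff_surjective.1 hPt
  rw [← LinearMap.ker_eq_bot, LinearMap.ker_eq_bot']
  intro f hf
  apply hj
  rw [map_zero]
  apply Metric.eq_zero_of_coef_aug hG
  intro n
  let φ : W := ⟨G.aug n ∘ₗ j.restrictScalars ℂ, fun b f => by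
    simpa using G.aug_smul n b (j f)⟩
  -- Every functional `ε(( , n))` on `F` factors through `P`, so all coefficients of an element of
  -- the kernel of `P` vanish.
  obtain ⟨ψ, hψ⟩ := hPt' φ
  have e : ψ.1 ∘ₗ P.restrictScalars ℂ = G.aug n ∘ₗ j.restrictScalars ℂ := congrArg Subtype.val hψ
  change ρ.coef (G.aug n) (j.restrictScalars ℂ f) = 0
  rw [← Coaction.coef_comp (j.restrictScalars ℂ) hjρ, ← e,
    Coaction.coef_comp (P.restrictScalars ℂ) hP]
  change ρF.coef ψ.1 (P f) = 0
  rw [hf, map_zero]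

end Quantum

/-! ### Covariant forms from unitary corepresentations, and the endomorphisms they define. -/

section Quantum

variable {A H : Type u} [Ring A] [HopfAlgebra ℂ A] [StarRing A] [StarModule ℂ A]
  [Ring H] [HopfAlgebra ℂ H] [StarRing H] [StarModule ℂ H] [HopfStarAlgebra A]
  {p : HopfSurj A H}

variable {M : Type u} [AddCommGroup M] [Module ℂ M] [Module p.coinv M] [Module p.coinvᵐᵒᵖ M]
  [IsScalarTower ℂ p.coinv M] [IsScalarTower ℂ p.coinvᵐᵒᵖ M] [SMulCommClass p.coinv p.coinvᵐᵒᵖ M]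

/-- A conjugate-linear map between comodules is compatible with the coactions and with `*`. -/
def IsStarColinear {M N : Type u} [AddCommGroup M] [Module ℂ M] [AddCommGroup N] [Module ℂ N]
    (ρM : Coaction A M) (ρN : Coaction A N) (f : M →ₛₗ[starRingEnd ℂ] N) : Prop :=
  ∀ m, ρN.toLin (f m) =
    TensorProduct.map (starLinearEquiv ℂ (A := A)).toLinearMap f (ρM.toLin m)

/-- A functional on `M / B⁺ M` can be replaced by a colinear map from `M / B⁺ M` to a unitary
corepresentation. -/
theorem exists_colinear_to_unitary (hH : IsCQGAlgebra H) (hMz : IsModzObject p.augIdeal M)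
    {ρ : Coaction A M} (hM : IsRelHopf p.coaction ρ) (φ : M →ₗ[ℂ] ℂ)
    (hφ : ∀ (b : p.coinv) m, φ (b • m) = p.counit b * φ m) :
    ∃ (I : Type) (_ : Fintype I) (_ : DecidableEq I) (w : Matrix I I H) (R : I → M →ₗ[ℂ] ℂ),
      IsUnitaryCorep w ∧
      (∀ i (b : p.coinv) m, R i (b • m) = p.counit b * R i m) ∧
      (∀ i m, p.rightCoact (ρ.coef (R i) m) = ∑ j, ρ.coef (R j) m ⊗ₜ[ℂ] w j i) ∧
      (∀ m, ρ.coef φ m = 0 → ∀ i, ρ.coef (R i) m = 0) ∧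
      (∀ m, (∀ i, R i m = 0) → φ m = 0) := by
  have := hMz.finite
  let π : A →ₗ[ℂ] H := (p.π : A →ₐ[ℂ] H).toLinearMap
  let t : M →ₗ[ℂ] H := π ∘ₗ ρ.coef φ
  have ht : ∀ (b : p.coinv) m, t (b • m) = p.counit b • t m := by
    intro b m
    change p.π _ = p.counit b • p.π _
    rw [hM.coef_smul φ hφ, map_mul, p.π_incl, smul_mul_assoc, one_mul]
  have := finiteDimensional_range t ht
  obtain ⟨I, _, _, w, hw, L, hL⟩ := hH.exists_unitary (LinearMap.range t)
  let l : I → H →ₗ[ℂ] ℂ := fun i => (EuclideanSpace.proj i).toLinearMap ∘ₗ L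
  let R : I → M →ₗ[ℂ] ℂ := fun i => l i ∘ₗ t
  have htρ : ∀ m, t.lTensor A (ρ.toLin m) =
      π.lTensor A (Coalgebra.comul (R := ℂ) (ρ.coef φ m)) := by
    intro m
    rw [ρ.comul_coef, LinearMap.lTensor_comp]
    rfl
  have hR : ∀ i m, ρ.coef (R i) m = TensorProduct.rid ℂ A ((l i).lTensor A
      (π.lTensor A (Coalgebra.comul (R := ℂ) (ρ.coef φ m)))) := by
    intro i m
    rw [← htρ, ρ.coef_apply, LinearMap.lTensor_comp]
    rfl
  -- Colinearity of `L`, transported along `t`. Combined with `comul_coef` it gives the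
  -- transformation of the coefficients under the right `H`-coaction.
  have hπR : ∀ i, π ∘ₗ ρ.coef (R i) = ∑ j, (R j).smulRight (w j i) := by
    intro i
    ext m
    have h1 := (hL (t m) ⟨m, rfl⟩).2 i
    have h2 : Coalgebra.comul (R := ℂ) (t m) = TensorProduct.map π π
        (Coalgebra.comul (R := ℂ) (ρ.coef φ m)) := p.comul_π _
    have e : ∀ X : A ⊗[ℂ] A, π (TensorProduct.rid ℂ A ((l i).lTensor A (π.lTensor A X))) =
        TensorProduct.rid ℂ H ((l i).lTensor H (TensorProduct.map π π X)) := by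
      intro X
      induction X using TensorProduct.induction_on with
      | zero => simp
      | add x y hx hy => simp only [map_add, hx, hy]
      | tmul x y => simp
    rw [LinearMap.comp_apply, hR, e, ← h2]
    rw [h1]
    simp [R, l]
  refine ⟨I, inferInstance, inferInstance, w, R, hw, ?_, ?_, ?_, ?_⟩
  · intro i b m
    change l i (t _) = _ * l i (t m)
    rw [ht, map_smul, smul_eq_mul]
  · intro i m
    rw [p.rightCoact_apply, ρ.comul_coef, ← LinearMap.comp_apply, ← LinearMap.lTensor_comp]
    change (π ∘ₗ ρ.coef (R i)).lTensor A _ = _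
    rw [hπR]
    have e : ∀ j (X : A ⊗[ℂ] M), ((R j).smulRight (w j i)).lTensor A X =
        TensorProduct.rid ℂ A ((R j).lTensor A X) ⊗ₜ[ℂ] w j i := by
      intro j X
      induction X using TensorProduct.induction_on with
      | zero => simp
      | add x y hx hy => simp only [map_add, hx, hy, TensorProduct.add_tmul]
      | tmul x y => simp [TensorProduct.smul_tmul]
    rw [show (∑ j, (R j).smulRight (w j i)).lTensor A = ∑ j, ((R j).smulRight (w j i)).lTensor A
      from map_sum (LinearMap.lTensorHom A) _ _]
    rw [LinearMap.sum_apply]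
    exact Finset.sum_congr rfl fun j _ => e j _
  · intro m hm i
    rw [hR, hm]
    simp
  · intro m hm
    have h1 : t m = 0 := (hL (t m) ⟨m, rfl⟩).1 (by ext i; exact hm i)
    rw [← ρ.counit_coef φ m]
    have h2 : Coalgebra.counit (R := ℂ) (p.π (ρ.coef φ m)) =
      Coalgebra.counit (R := ℂ) (ρ.coef φ m) := CoalgHomClass.counit_comp_apply _ _
    rw [← h2, show p.π (ρ.coef φ m) = 0 from h1, map_zero]

/-- A functional on `M / B⁺ M` gives rise to a covariant `B`-bilinear map `β : M ⊗_B M → B` for which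
`ε(β(m, m*))` is positive outside of the kernel. -/
theorem exists_covariant_form (hH : IsCQGAlgebra H) (hMz : IsModzObject p.augIdeal M)
    {ρ : Coaction A M} (hM : IsRelHopf p.coaction ρ) (s : BimoduleStar p.coinv M)
    (hs : IsStarColinear ρ ρ s.toLin) (φ : M →ₗ[ℂ] ℂ)
    (hφ : ∀ (b : p.coinv) m, φ (b • m) = p.counit b * φ m) :
    ∃ β : M →ₗ[ℂ] M →ₗ[ℂ] p.coinv,
      (∀ (b : p.coinv) m n, β (b • m) n = b * β m n) ∧
      (∀ (b : p.coinv) m n, β m (MulOpposite.op b • n) = β m n * b) ∧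
      (∀ (b : p.coinv) m n, β (MulOpposite.op b • m) n = β m (b • n)) ∧
      IsCovariantBilinear p.coaction ρ ρ β ∧
      (∀ m, ρ.coef φ m = 0 → ∀ n, β m n = 0 ∧ β n (s.toLin m) = 0) ∧
      (∀ m, β m (s.toLin m) = 0 → φ m = 0) := by
  obtain ⟨I, _, _, w, R, hw, hRb, hRw, hR0, hRφ⟩ := exists_colinear_to_unitary hH hMz hM φ hφ
  let r : I → M →ₗ[ℂ] A := fun i => ρ.coef (R i)
  let r' : I → M →ₗ[ℂ] A := fun i => ρ.coef (conjComp (R i) s.toLin)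
  have hr' : ∀ i m, r' i m = star (r i (s.toLin m)) := fun i m => Coaction.coef_conjComp _ hs _ _
  -- The right coaction produces the factors `∑ᵢ w j i (w k i)*`, which are `δ_{jk}` by unitarity.
  have hmem : ∀ m n, ∑ i, r i m * r' i n ∈ p.coinv := by
    intro m n
    change p.rightCoact _ = (∑ i, r i m * r' i n) ⊗ₜ[ℂ] 1
    have hw' : ∀ j k, ∑ i, w j i * star (w k i) = (1 : Matrix I I H) j k := fun j k =>
      congrFun (congrFun hw.mul_star j) k
    simp only [map_sum, map_mul, hr', p.rightCoact_star, r, hRw, star_sum, TensorProduct.star_tmul,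
      Finset.sum_mul, Finset.mul_sum, Algebra.TensorProduct.tmul_mul_tmul]
    rw [Finset.sum_comm]
    rw [TensorProduct.sum_tmul]
    refine Finset.sum_congr rfl fun j _ => ?_
    rw [Finset.sum_comm, Finset.sum_eq_single j]
    · rw [← TensorProduct.tmul_sum, hw', Matrix.one_apply_eq]
    · intro k _ hk
      rw [← TensorProduct.tmul_sum, hw', Matrix.one_apply_ne hk, TensorProduct.tmul_zero]
    · simp
  let β : M →ₗ[ℂ] M →ₗ[ℂ] p.coinv := LinearMap.mk₂ ℂ (fun m n => ⟨∑ i, r i m * r' i n, hmem m n⟩)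
    (fun m m' n => Subtype.ext (by simp [add_mul, Finset.sum_add_distrib]))
    (fun c m n => Subtype.ext (by simp [Finset.smul_sum]))
    (fun m n n' => Subtype.ext (by simp [mul_add, Finset.sum_add_distrib]))
    (fun c m n => Subtype.ext (by simp [Finset.smul_sum]))
  have hβ : ∀ m n, p.incl (β m n) = ∑ i, r i m * r' i n := fun m n => rfl
  have hincl_mul : ∀ b c : p.coinv, p.incl (b * c) = p.incl b * p.incl c := fun _ _ => rfl
  have hr1 : ∀ i (b : p.coinv) m, r i (b • m) = p.incl b * r i m := fun i b m =>
    hM.coef_smul _ (hRb i) b m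
  -- Here `M B⁺ = B⁺M` enters: it makes each `r i` right linear, which is what balances `β` over
  -- `B`.
  have hr2 : ∀ i (b : p.coinv) m, r i (MulOpposite.op b • m) = r i m * p.incl b := fun i b m =>
    hM.coef_op_smul _ (hMz.map_op_smul (hRb i)) b m
  have hstar : ∀ b : p.coinv, p.incl (star b) = star (p.incl b) := fun _ => rfl
  refine ⟨β, ?_, ?_, ?_, ?_, ?_, ?_⟩
  · intro b m n
    apply p.incl_injective
    simp only [hincl_mul, hβ, hr1, Finset.mul_sum, mul_assoc]
  · intro b m n
    apply p.incl_injective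
    simp only [hincl_mul, hβ, hr', s.map_op_smul, hr1, star_mul, hstar, star_star, Finset.sum_mul,
      mul_assoc]
  · intro b m n
    apply p.incl_injective
    simp only [hβ, hr', s.map_smul, hr2, star_mul, hstar, star_star, mul_assoc]
  · intro m n
    apply lTensor_injective A p.incl_injective
    rw [p.incl_lTensor_coaction, hβ]
    have e : ∀ X Y : A ⊗[ℂ] M, p.incl.lTensor A (TensorProduct.map₂ (LinearMap.mul ℂ A) β X Y) =
        ∑ i, (r i).lTensor A X * (r' i).lTensor A Y := by
      intro X Y
      induction X using TensorProduct.induction_on with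
      | zero => simp
      | add X X' h h' =>
        simp only [map_add, LinearMap.add_apply, h, h', add_mul, Finset.sum_add_distrib]
      | tmul a m =>
        induction Y using TensorProduct.induction_on with
        | zero => simp
        | add X X' h h' => simp only [map_add, h, h', mul_add, Finset.sum_add_distrib]
        | tmul a' n => simp [hβ, TensorProduct.tmul_sum]
    simp only [e, map_sum, Bialgebra.comul_mul, r, r', ρ.comul_coef]
  · intro m hm n
    constructor
    · apply p.incl_injective
      rw [hβ, map_zero]
      exact Finset.sum_eq_zero fun i _ => by simp only [r, hR0 m hm, zero_mul]
    · apply p.incl_injective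
      rw [hβ, map_zero]
      exact Finset.sum_eq_zero fun i _ => by
        simp only [hr', s.invol, r, hR0 m hm, star_zero, mul_zero]
  · intro m hm
    apply hRφ
    have h1 := congrArg (Coalgebra.counit (R := ℂ)) (hβ m (s.toLin m))
    rw [hm] at h1
    simp only [map_zero, map_sum, Bialgebra.counit_mul, hr', s.invol,
      HopfStarAlgebra.counit_star, r, ρ.counit_coef] at h1
    intro i
    -- This sum is `ε(β(m, m*))`, because `r' i (m*) = (r i m)*` and `ε(r i m) = R i m`.
    have h2 : ∑ i, ‖R i m‖ ^ 2 = 0 := by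
      have : ((∑ i, ‖R i m‖ ^ 2 : ℝ) : ℂ) = ∑ i, R i m * star (R i m) := by
        push_cast
        exact Finset.sum_congr rfl fun i _ => (Complex.mul_conj' (R i m)).symm
      rw [← h1] at this
      exact_mod_cast this
    have h3 := (Finset.sum_eq_zero_iff_of_nonneg fun i _ => by positivity).1 h2 i (Finset.mem_univ i)
    simpa using h3

/-- A covariant `B`-bilinear map is of the form `(m, n) ↦ (m, θ(n))` for a morphism `θ`. -/
theorem exists_endomorphism {ρ : Coaction A M} {hM : IsRelHopf p.coaction ρ}
    {G : Metric p.coinv M} (hG : G.IsCovariant hM) (β : M →ₗ[ℂ] M →ₗ[ℂ] p.coinv)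
    (h1 : ∀ (b : p.coinv) m n, β (b • m) n = b * β m n)
    (h2 : ∀ (b : p.coinv) m n, β m (MulOpposite.op b • n) = β m n * b)
    (h3 : ∀ (b : p.coinv) m n, β (MulOpposite.op b • m) n = β m (b • n))
    (h4 : IsCovariantBilinear p.coaction ρ ρ β) :
    ∃ θ : M →ₗ[p.coinv] M, (∀ m n, G.val m (θ n) = β m n) ∧
      (∀ (b : p.coinv) m, θ (MulOpposite.op b • m) = MulOpposite.op b • θ m) ∧
      ∀ m, ρ.toLin (θ m) = (θ.restrictScalars ℂ).lTensor A (ρ.toLin m) := by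
  choose θ hθ using fun n => G.exists_eq_val
    { toFun := fun m => β m n
      map_add' := fun m m' => by simp
      map_smul' := fun b m => h1 b m n }
  have hθ : ∀ m n, G.val m (θ n) = β m n := fun m n => (hθ n m).symm
  let θ' : M →ₗ[p.coinv] M :=
    { toFun := θ
      map_add' := fun m n => G.ext_right fun l => by
        rw [hθ, G.val_add_right, hθ, hθ, map_add]
      map_smul' := fun b m => G.ext_right fun l => by
        rw [hθ, ← h3, ← hθ, G.val_op_smul_left]; rfl }
  refine ⟨θ', hθ, fun b m => G.ext_right fun l => ?_, fun n => G.lTensor_ext fun m => ?_⟩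
  · change G.val l (θ _) = G.val l (_ • θ m)
    rw [hθ, h2, G.val_op_smul_right, hθ]
  -- Both `( , )` and `β` satisfy the antipode identity, whose left side depends only on the map `m
  -- ↦ (m, θ(n)) = β(m, n)`. Comparing the right sides gives colinearity of `θ`.
  · rw [← hG.isCovariantBilinear.antipode_mul]
    have e : G.bilin.flip (θ' n) = β.flip n := LinearMap.ext fun m => hθ m n
    have e2 : G.bilin m ∘ₗ θ'.restrictScalars ℂ = β m := LinearMap.ext fun n => hθ m n
    rw [e, h4.antipode_mul, ← e2, LinearMap.lTensor_comp]
    rfl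

end Quantum

/-! ### Simple objects and isotropy of conjugate summands. -/

section Quantum

variable {A H : Type u} [Ring A] [HopfAlgebra ℂ A] [StarRing A] [StarModule ℂ A]
  [Ring H] [HopfAlgebra ℂ H] [StarRing H] [StarModule ℂ H] [HopfStarAlgebra A]
  {p : HopfSurj A H}

variable {M : Type u} [AddCommGroup M] [Module ℂ M] [Module p.coinv M] [Module p.coinvᵐᵒᵖ M]
  [IsScalarTower ℂ p.coinv M] [IsScalarTower ℂ p.coinvᵐᵒᵖ M] [SMulCommClass p.coinv p.coinvᵐᵒᵖ M]
variable {E : Type u} [AddCommGroup E] [Module ℂ E] [Module p.coinv E] [Module p.coinvᵐᵒᵖ E]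
  [IsScalarTower ℂ p.coinv E] [IsScalarTower ℂ p.coinvᵐᵒᵖ E] [SMulCommClass p.coinv p.coinvᵐᵒᵖ E]
variable {F : Type u} [AddCommGroup F] [Module ℂ F] [Module p.coinv F] [Module p.coinvᵐᵒᵖ F]
  [IsScalarTower ℂ p.coinv F] [IsScalarTower ℂ p.coinvᵐᵒᵖ F] [SMulCommClass p.coinv p.coinvᵐᵒᵖ F]

/-- `f` is a morphism of relative Hopf modules. -/
structure IsRelHopfHom (ρE : Coaction A E) (ρM : Coaction A M) (f : E →ₗ[p.coinv] M) : Prop where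
  op_smul : ∀ (b : p.coinv) e, f (MulOpposite.op b • e) = MulOpposite.op b • f e
  coact : ∀ e, ρM.toLin (f e) = (f.restrictScalars ℂ).lTensor A (ρE.toLin e)

theorem IsRelHopfHom.comp {ρE : Coaction A E} {ρM : Coaction A M} {ρF : Coaction A F}
    {f : E →ₗ[p.coinv] M} {g : F →ₗ[p.coinv] E} (hf : IsRelHopfHom ρE ρM f)
    (hg : IsRelHopfHom ρF ρE g) : IsRelHopfHom ρF ρM (f ∘ₗ g) where
  op_smul b e := by simp only [LinearMap.comp_apply, hg.op_smul, hf.op_smul]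
  coact e := by
    rw [LinearMap.comp_apply, hf.coact, hg.coact, ← LinearMap.comp_apply, ← LinearMap.lTensor_comp]
    rfl

/-- The image of a morphism. -/
def IsRelHopfHom.range {ρE : Coaction A E} {ρF : Coaction A F} {T : F →ₗ[p.coinv] E}
    (hT : IsRelHopfHom ρF ρE T) : SubBimodule p.coinv E :=
  { LinearMap.range T with
    op_smul_mem := by
      rintro b _ ⟨f, rfl⟩
      exact ⟨_, hT.op_smul b f⟩ }

/-- A nonzero morphism to a simple object is surjective. -/
theorem IsSimpleModz.surjective {ρE : Coaction A E} {ρF : Coaction A F}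
    (hE : IsSimpleModz p.augIdeal ρE) (hF : IsModzObject p.augIdeal F)
    {T : F →ₗ[p.coinv] E} (hT : IsRelHopfHom ρF ρE T) (h0 : T ≠ 0) : Function.Surjective T := by
  let K := hT.range
  let T' : F →ₗ[p.coinv] K := T.codRestrict _ fun f => ⟨f, rfl⟩
  have hT' : Function.Surjective T' := by
    rintro ⟨_, f, rfl⟩
    exact ⟨f, rfl⟩
  have hT'op : ∀ (b : p.coinv) f, T' (MulOpposite.op b • f) = MulOpposite.op b • T' f :=
    fun b f => Subtype.ext (hT.op_smul b f)
  have hst : ρE.Stable K.incl := by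
    rintro ⟨_, f, rfl⟩
    refine ⟨(T'.restrictScalars ℂ).lTensor A (ρF.toLin f), ?_⟩
    rw [← LinearMap.comp_apply, ← LinearMap.lTensor_comp]
    exact (hT.coact f).symm
  -- Images inherit finite generation and `K B⁺ = B⁺K` from `F`. The same is not clear for kernels,
  -- so simplicity is used only for surjectivity.
  have hK : IsModzObject p.augIdeal K := by
    have := hF.finite
    refine ⟨Module.Finite.of_surjective T' hT', ?_⟩
    have e1 : {x : K | ∃ b ∈ p.augIdeal, ∃ m : K, x = MulOpposite.op b • m} =
        T'.restrictScalars ℂ '' {x : F | ∃ b ∈ p.augIdeal, ∃ m : F, x = MulOpposite.op b • m} := by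
      ext x
      constructor
      · rintro ⟨b, hb, m, rfl⟩
        obtain ⟨f, rfl⟩ := hT' m
        exact ⟨_, ⟨b, hb, f, rfl⟩, hT'op b f⟩
      · rintro ⟨_, ⟨b, hb, f, rfl⟩, rfl⟩
        exact ⟨b, hb, T' f, hT'op b f⟩
    have e2 : {x : K | ∃ b ∈ p.augIdeal, ∃ m : K, x = b • m} =
        T'.restrictScalars ℂ '' {x : F | ∃ b ∈ p.augIdeal, ∃ m : F, x = b • m} := by
      ext x
      constructor
      · rintro ⟨b, hb, m, rfl⟩
        obtain ⟨f, rfl⟩ := hT' m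
        exact ⟨_, ⟨b, hb, f, rfl⟩, T'.map_smul b f⟩
      · rintro ⟨_, ⟨b, hb, f, rfl⟩, rfl⟩
        exact ⟨b, hb, T' f, T'.map_smul b f⟩
    rw [e1, e2, ← Submodule.map_span, ← Submodule.map_span, hF.comm]
  rcases hE.eq_bot_or_eq_top K hst hK with h | h
  · exact absurd (LinearMap.range_eq_bot.1 h) h0
  · exact LinearMap.range_eq_top.1 h

/-- A bijective morphism is an isomorphism of relative Hopf modules. -/
theorem IsRelHopfHom.isIso {ρE : Coaction A E} {ρF : Coaction A F}
    {T : F →ₗ[p.coinv] E} (hT : IsRelHopfHom ρF ρE T) (hb : Function.Bijective T) :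
    IsIsoRelHopf (B := p.coinv) ρE ρF := by
  let e := LinearEquiv.ofBijective T hb
  have he : ∀ f, e.symm (T f) = f := fun f => e.symm_apply_apply f
  refine ⟨e.symm, fun b m => ?_, fun m => ?_⟩
  · obtain ⟨f, rfl⟩ := hb.2 m
    rw [← hT.op_smul, he, he]
  · obtain ⟨f, rfl⟩ := hb.2 m
    rw [he, hT.coact, ← LinearMap.comp_apply, ← LinearMap.lTensor_comp]
    have : e.symm.toLinearMap.restrictScalars ℂ ∘ₗ T.restrictScalars ℂ = LinearMap.id :=
      LinearMap.ext he
    rw [this]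
    simp

/-- `M = E ⊕ F` as relative Hopf modules, and the involution of `M` exchanges `E` and `F`. -/
structure IsConjugateDecomposition (ρ : Coaction A M) (s : BimoduleStar p.coinv M)
    (ρE : Coaction A E) (ρF : Coaction A F) (i : E →ₗ[p.coinv] M) (j : F →ₗ[p.coinv] M) :
    Prop where
  decomp : Function.Bijective fun x : E × F => i x.1 + j x.2
  left : IsRelHopfHom ρE ρ i
  right : IsRelHopfHom ρF ρ j
  star_left : ∀ e, ∃ f, s.toLin (i e) = j f
  star_right : ∀ f, ∃ e, s.toLin (j f) = i e

namespace IsConjugateDecomposition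

variable {ρ : Coaction A M} {s : BimoduleStar p.coinv M}
    {ρE : Coaction A E} {ρF : Coaction A F} {i : E →ₗ[p.coinv] M} {j : F →ₗ[p.coinv] M}

theorem symm (h : IsConjugateDecomposition ρ s ρE ρF i j) :
    IsConjugateDecomposition ρ s ρF ρE j i where
  decomp := by
    have : (fun x : F × E => j x.1 + i x.2) =
        (fun x : E × F => i x.1 + j x.2) ∘ Equiv.prodComm F E := by
      ext x; exact add_comm _ _
    rw [this]
    exact h.decomp.comp (Equiv.bijective _)
  left := h.right
  right := h.left
  star_left := h.star_right
  star_right := h.star_left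

theorem exists_fst (h : IsConjugateDecomposition ρ s ρE ρF i j) :
    ∃ q : M →ₗ[p.coinv] E, IsRelHopfHom ρ ρE q ∧ (∀ e, q (i e) = e) ∧ ∀ f, q (j f) = 0 := by
  let e := LinearEquiv.ofBijective (i.coprod j) h.decomp
  let q : M →ₗ[p.coinv] E := LinearMap.fst _ _ _ ∘ₗ e.symm.toLinearMap
  have hq : ∀ x y, q (i x + j y) = x := fun x y => by
    change (e.symm (e (x, y))).1 = x
    rw [e.symm_apply_apply]
  have h1 : ∀ x, q (i x) = x := fun x => by simpa using hq x 0
  have h2 : ∀ y, q (j y) = 0 := fun y => by simpa using hq 0 y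
  refine ⟨q, ⟨fun b m => ?_, fun m => ?_⟩, h1, h2⟩
  · obtain ⟨⟨x, y⟩, rfl⟩ := h.decomp.2 m
    dsimp only
    rw [hq, smul_add, ← h.left.op_smul, ← h.right.op_smul, hq]
  · obtain ⟨⟨x, y⟩, rfl⟩ := h.decomp.2 m
    dsimp only
    have e1 : q.restrictScalars ℂ ∘ₗ i.restrictScalars ℂ = LinearMap.id := LinearMap.ext h1
    have e2 : q.restrictScalars ℂ ∘ₗ j.restrictScalars ℂ = 0 := LinearMap.ext h2
    rw [hq, map_add, map_add, h.left.coact, h.right.coact, ← LinearMap.lTensor_comp_apply,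
      ← LinearMap.lTensor_comp_apply, e1, e2]
    simp

theorem left_injective (h : IsConjugateDecomposition ρ s ρE ρF i j) : Function.Injective i := by
  obtain ⟨q, -, hq, -⟩ := h.exists_fst
  exact Function.LeftInverse.injective hq

/-- The involution of `M` becomes a conjugate-linear colinear map `E → F`, so that morphisms `F → E`
can be composed with themselves. -/
theorem exists_star (h : IsConjugateDecomposition ρ s ρE ρF i j)
    (hs : IsStarColinear ρ ρ s.toLin) :
    ∃ σ : E →ₛₗ[starRingEnd ℂ] F, (∀ e, j (σ e) = s.toLin (i e)) ∧ IsStarColinear ρE ρF σ := by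
  obtain ⟨q, hq, hqj, -⟩ := h.symm.exists_fst
  let σ : E →ₛₗ[starRingEnd ℂ] F :=
    (q.restrictScalars ℂ).comp (s.toLin.comp (i.restrictScalars ℂ))
  refine ⟨σ, fun e => ?_, fun e => ?_⟩
  · obtain ⟨f, hf⟩ := h.star_left e
    change j (q (s.toLin (i e))) = _
    rw [hf, hqj]
  · change ρF.toLin (q (s.toLin (i e))) = _
    rw [hq.coact, hs, h.left.coact]
    generalize ρE.toLin e = X
    induction X using TensorProduct.induction_on with
    | zero => simp
    | add X Y hX hY => simp only [map_add, hX, hY]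
    | tmul a m => simp [σ]

/-- If the conjugate objects `E` and `F` are simple and not isomorphic, then `F` is isotropic. -/
theorem isotropic_right (h : IsConjugateDecomposition ρ s ρE ρF i j)
    (hs : IsStarColinear ρ ρ s.toLin) (hH : IsCQGAlgebra H) (hMz : IsModzObject p.augIdeal M)
    {hM : IsRelHopf p.coaction ρ} {G : Metric p.coinv M} (hG : G.IsCovariant hM)
    (hE : IsSimpleModz p.augIdeal ρE) (hF : IsSimpleModz p.augIdeal ρF)
    (hEF : ¬ IsIsoRelHopf (B := p.coinv) ρE ρF) (x y : F) : G.val (j x) (j y) = 0 := by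
  obtain ⟨q, hq, hqi, hqj⟩ := h.exists_fst
  obtain ⟨q', hq', hqj', hqi'⟩ := h.symm.exists_fst
  obtain ⟨σ, hσ, hσρ⟩ := h.exists_star hs
  obtain ⟨τ, hτ, -⟩ := h.symm.exists_star hs
  have hiinj := h.left_injective
  have hjinj := h.symm.left_injective
  -- If all these functionals vanished on `E`, so would their coefficients, forcing `E = 0`.
  obtain ⟨e₀, m₀, h₀⟩ : ∃ e m, G.aug m (i e) ≠ 0 := by
    by_contra! hc
    have := hE.nontrivial
    obtain ⟨e, he⟩ := exists_ne (0 : E)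
    apply he
    apply hiinj
    rw [map_zero]
    apply Metric.eq_zero_of_coef_aug hG
    intro n
    have e1 : G.aug n ∘ₗ i.restrictScalars ℂ = 0 := LinearMap.ext fun e => hc e n
    have e2 := Coaction.coef_comp (i.restrictScalars ℂ) h.left.coact (G.aug n) e
    rw [e1] at e2
    change _ = ρ.coef (G.aug n) (i e) at e2
    rw [← e2]
    simp [Coaction.coef]
  -- Projecting to `E` first makes `φ` vanish on `F` while keeping `φ(i e₀) ≠ 0`.
  let φ : M →ₗ[ℂ] ℂ := G.aug m₀ ∘ₗ (i ∘ₗ q).restrictScalars ℂ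
  have hφ : ∀ (b : p.coinv) m, φ (b • m) = p.counit b * φ m := fun b m => by
    change G.aug m₀ (i (q (b • m))) = _ * G.aug m₀ (i (q m))
    rw [map_smul, map_smul, G.aug_smul]
  have hφj : ∀ f, ρ.coef φ (j f) = 0 := by
    intro f
    have e1 : φ ∘ₗ j.restrictScalars ℂ = 0 := LinearMap.ext fun f => by
      change G.aug m₀ (i (q (j f))) = 0
      rw [hqj, map_zero, map_zero]
    have e2 := Coaction.coef_comp (j.restrictScalars ℂ) h.right.coact φ f
    rw [e1] at e2
    change _ = ρ.coef φ (j f) at e2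
    rw [← e2]
    simp [Coaction.coef]
  obtain ⟨β, hβ1, hβ2, hβ3, hβ4, hβ5, hβ6⟩ := exists_covariant_form hH hMz hM s hs φ hφ
  obtain ⟨θ, hθ, hθop, hθρ⟩ := exists_endomorphism hG β hβ1 hβ2 hβ3 hβ4
  have hθj : IsRelHopfHom ρF ρ (θ ∘ₗ j) := IsRelHopfHom.comp ⟨hθop, hθρ⟩ h.right
  have hsplit : ∀ m, m = i (q m) + j (q' m) := by
    intro m
    obtain ⟨⟨e, f⟩, rfl⟩ := h.decomp.2 m
    simp [hqi, hqj, hqi', hqj']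
  let T : F →ₗ[p.coinv] E := q ∘ₗ θ ∘ₗ j
  let U : F →ₗ[p.coinv] F := q' ∘ₗ θ ∘ₗ j
  have hT : IsRelHopfHom ρF ρE T := hq.comp hθj
  have hU : IsRelHopfHom ρF ρF U := hq'.comp hθj
  have hT0 : T = 0 := by
    by_contra hT0
    have hTs := hE.surjective hF.isObject hT hT0
    have hσs : Function.Surjective σ := fun f => ⟨τ f, hjinj (by rw [hσ, hτ, s.invol])⟩
    have hσb : ∀ (b : p.coinv) e, σ (b • e) = MulOpposite.op (star b) • σ e := fun b e => hjinj (by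
      rw [hσ, map_smul, s.map_smul, h.right.op_smul, hσ])
    have hσb' : ∀ (b : p.coinv) e, σ (MulOpposite.op b • e) = star b • σ e := fun b e => hjinj (by
      rw [hσ, h.left.op_smul, s.map_op_smul, map_smul, hσ])
    -- `σ ∘ T` is conjugate-linear and exchanges left and right actions; its square is left
    -- `B`-linear and colinear again.
    let P : F →ₗ[p.coinv] F :=
      { toFun := fun f => σ (T (σ (T f)))
        map_add' := fun f f' => by simp only [map_add]
        map_smul' := fun b f => by
          rw [map_smul, hσb, hT.op_smul, hσb', star_star, RingHom.id_apply] }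
    have hPs : Function.Surjective P := hσs.comp (hTs.comp (hσs.comp hTs))
    have := hF.isObject.finite
    have hPinj : Function.Injective P := by
      refine injective_of_surjective_endomorphism hG j hjinj h.right.coact P (fun f => ?_) hPs
      change ρF.toLin (σ (T (σ (T f)))) = _
      rw [hσρ, hT.coact, hσρ, hT.coact]
      generalize ρF.toLin f = X
      induction X using TensorProduct.induction_on with
      | zero => simp
      | add X Y hX hY => simp only [map_add, hX, hY]
      | tmul a m => simp [P]
    have hTinj : Function.Injective T := fun a b hab => hPinj (by
      change σ (T (σ (T a))) = σ (T (σ (T b)))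
      rw [hab])
    exact hEF (hT.isIso ⟨hTinj, hTs⟩)
  have hθU : ∀ f, θ (j f) = j (U f) := fun f => by
    have h1 := hsplit (θ (j f))
    have h2 : q (θ (j f)) = 0 := LinearMap.congr_fun hT0 f
    rw [h2, map_zero, zero_add] at h1
    exact h1
  -- If `U = 0` then `θ` kills `F`, which contains `(i e₀)*`. Hence `β(i e₀, (i e₀)*) = 0`, and
  -- positivity forces `φ(i e₀) = 0`.
  have hU0 : U ≠ 0 := by
    intro hU0
    apply h₀
    have h1 : φ (i e₀) = G.aug m₀ (i e₀) := by
      change G.aug m₀ (i (q (i e₀))) = _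
      rw [hqi]
    rw [← h1]
    apply hβ6
    rw [← hθ, ← hσ, hθU, hU0, LinearMap.zero_apply, map_zero, G.val_zero_right]
  -- With `y` replaced by `U y`, the pairing becomes `(j x, θ(j y)) = β(j x, j y)`, which is zero
  -- since the coefficients of `φ` vanish on `F`.
  obtain ⟨y, rfl⟩ := hF.surjective hF.isObject hU hU0 y
  rw [← hθU, hθ]
  exact (hβ5 _ (hφj x) _).1

end IsConjugateDecomposition

/-! ### Hermitian metrics -/

/-- If the form restricted to `E` is nondegenerate, then it is a covariant Hermitian metric. -/
theorem Metric.isCovariantHermitianMetric_form {ρ : Coaction A M} {s : BimoduleStar p.coinv M}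
    {ρE : Coaction A E} {i : E →ₗ[p.coinv] M} (hi : IsRelHopfHom ρE ρ i)
    (hs : IsStarColinear ρ ρ s.toLin) {hM : IsRelHopf p.coaction ρ} {G : Metric p.coinv M}
    (hG : G.IsCovariant hM) (hreal : G.IsReal s) (hb : Function.Bijective (G.form s i)) :
    IsCovariantHermitianMetric p.coaction ρE (G.form s i) where
  bijective := hb
  map_smul b x := by
    ext1 e
    change G.val (i e) (s.toLin (i (MulOpposite.op (star b) • x.unbar))) =
      G.val (i (MulOpposite.op b • e)) (s.toLin (i x.unbar))
    rw [hi.op_smul, hi.op_smul, s.map_op_smul, star_star, G.val_op_smul_left]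
  map_op_smul b x := by
    ext1 e
    change G.val (i e) (s.toLin (i (star b • x.unbar))) = G.val (i e) (s.toLin (i x.unbar)) * b
    rw [_root_.map_smul, s.map_smul, star_star, G.val_op_smul_right]
  symm e f := by
    change star (G.val (i f) (s.toLin (i e))) = G.val (i e) (s.toLin (i f))
    rw [← G.star_val s hreal, s.invol, star_star]
  colinear x m := by
    obtain ⟨e⟩ := x
    -- The coaction of the left dual has the shape of the antipode identity, taken here at `n = (i
    -- e)*`.
    have h1 := hG.isCovariantBilinear.antipode_mul (i m) (s.toLin (i e))
    have e1 : ∀ X : A ⊗[ℂ] E, (dualEval p.coinv m).lTensor A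
        ((G.form s i).lTensor A (Conj.tensorBar A E X)) = (G.bilin (i m)).lTensor A
        (TensorProduct.map (starLinearEquiv ℂ (A := A)).toLinearMap s.toLin
          ((i.restrictScalars ℂ).lTensor A X)) := by
      intro X
      induction X using TensorProduct.induction_on with
      | zero => simp
      | add X Y hX hY => simp only [map_add, hX, hY]
      | tmul a m => rfl
    change (dualEval p.coinv m).lTensor A
      ((G.form s i).lTensor A (Conj.tensorBar A E (ρE.toLin e))) = _
    rw [e1, ← hi.coact, ← hs, ← h1, hi.coact, LinearMap.lTensor, ← LinearMap.comp_apply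
      (TensorProduct.map _ _) (TensorProduct.map _ _), ← TensorProduct.map_comp]
    rfl

theorem Metric.bijective_form_id {s : BimoduleStar p.coinv M} (G : Metric p.coinv M) :
    Function.Bijective (G.form s LinearMap.id) := by
  constructor
  · intro x y hxy
    have : s.toLin x.unbar = s.toLin y.unbar :=
      G.ext_right fun m => LinearMap.congr_fun hxy m
    have h := congrArg s.toLin this
    rw [s.invol, s.invol] at h
    exact Conj.ext h
  · intro f
    obtain ⟨y, hy⟩ := G.exists_eq_val f
    refine ⟨Conj.bar (s.toLin y), ?_⟩
    ext1 m
    change G.val m (s.toLin (s.toLin y)) = _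
    rw [s.invol, hy]

/-- Isotropy makes `( , )` a perfect pairing between `E` and `F`, and `F` is the conjugate of `E`
through `*`. -/
theorem IsConjugateDecomposition.bijective_form {ρ : Coaction A M} {s : BimoduleStar p.coinv M}
    {ρE : Coaction A E} {ρF : Coaction A F} {i : E →ₗ[p.coinv] M} {j : F →ₗ[p.coinv] M}
    (h : IsConjugateDecomposition ρ s ρE ρF i j) (G : Metric p.coinv M)
    (hi : ∀ x y, G.val (i x) (i y) = 0) (hj : ∀ x y, G.val (j x) (j y) = 0) :
    Function.Bijective (G.form s i) := by
  constructor
  · intro x y hxy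
    have : s.toLin (i x.unbar) = s.toLin (i y.unbar) := G.ext_right fun m => by
      obtain ⟨⟨e, f⟩, rfl⟩ := h.decomp.2 m
      obtain ⟨x', hx'⟩ := h.star_left x.unbar
      obtain ⟨y', hy'⟩ := h.star_left y.unbar
      have : G.val (i e) (s.toLin (i x.unbar)) = G.val (i e) (s.toLin (i y.unbar)) :=
        LinearMap.congr_fun hxy e
      dsimp only
      rw [G.val_add_left, G.val_add_left, this, hx', hy', hj, hj]
    have h' := congrArg s.toLin this
    rw [s.invol, s.invol] at h'
    exact Conj.ext (h.left_injective h')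
  · intro f
    obtain ⟨q, -, hq, -⟩ := h.exists_fst
    -- Extend `f` by zero on `F` and represent it by `y = i a + j b`. The part `i a` is invisible on
    -- `E`, and `j b` is the conjugate of an element of `i E`.
    obtain ⟨y, hy⟩ := G.exists_eq_val (f ∘ₗ q)
    obtain ⟨⟨a, b⟩, rfl⟩ := h.decomp.2 y
    obtain ⟨c, hc⟩ := h.star_right b
    refine ⟨Conj.bar c, ?_⟩
    ext1 e
    have := hy (i e)
    rw [LinearMap.comp_apply, hq, G.val_add_right, hi, zero_add] at this
    rw [this]
    change G.val (i e) (s.toLin (i c)) = _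
    rw [← hc, s.invol]

theorem IsConjugateDecomposition.isDirectSum {ρ : Coaction A M} {s : BimoduleStar p.coinv M}
    {ρE : Coaction A E} {ρF : Coaction A F} {i : E →ₗ[p.coinv] M} {j : F →ₗ[p.coinv] M}
    (h : IsConjugateDecomposition ρ s ρE ρF i j) (G : Metric p.coinv M)
    (hi : ∀ x y, G.val (i x) (i y) = 0) (hj : ∀ x y, G.val (j x) (j y) = 0) :
    IsDirectSum i j (G.form s LinearMap.id) (G.form s i) (G.form s j) where
  decomp := h.decomp
  apply ω η ω' η' := by
    obtain ⟨a, ha⟩ := h.star_left ω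
    obtain ⟨b, hb⟩ := h.star_right ω'
    change G.val (i η + j η') (s.toLin (i ω + j ω')) =
      G.val (i η) (s.toLin (i ω)) + G.val (j η') (s.toLin (j ω'))
    rw [map_add, G.val_add_left, G.val_add_right, G.val_add_right, ha, hb, hi, hj, add_zero,
      zero_add]

end Quantum

/-! ### The decomposition of one-forms into types `(1,0)` and `(0,1)`. -/

section Forms

variable {A H : Type u} [Ring A] [HopfAlgebra ℂ A] [StarRing A] [StarModule ℂ A]
  [Ring H] [HopfAlgebra ℂ H] [StarRing H] [StarModule ℂ H] [HopfStarAlgebra A]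
  {p : HopfSurj A H} {D : DiffCalculus p.coinv} {S : D.StarStructure}

theorem DiffCalculus.Covariance.isStarColinear_onForms (C : D.Covariance p.coaction S) (k : ℕ) :
    IsStarColinear (C.onForms k) (C.onForms k) (S.onForms k).toLin := by
  intro ω
  apply lTensor_injective A (D.forms k).incl_injective
  have r := fun ω => C.δ.lTensor_restrictLin (D.forms k).incl (D.forms k).incl_injective
    (C.stable k) ω
  have e : ∀ X : A ⊗[ℂ] D.forms k, (D.forms k).incl.lTensor A
      (TensorProduct.map (starLinearEquiv ℂ (A := A)).toLinearMap (S.onForms k).toLin X) =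
      TensorProduct.map (starLinearEquiv ℂ (A := A)).toLinearMap S.toLin
        ((D.forms k).incl.lTensor A X) := by
    intro X
    induction X using TensorProduct.induction_on with
    | zero => simp
    | add X Y hX hY => simp only [map_add, hX, hY]
    | tmul a m => rfl
  rw [e]
  exact (r _).trans ((C.map_star ω).trans (congrArg _ (r ω).symm))

/-- The inclusion of `Ω^(p,q)` in `Ω^(p+q)` is a morphism of relative Hopf modules. -/
theorem DiffCalculus.ComplexStructure.IsCovariant.isRelHopfHom {K : D.ComplexStructure S}
    {C : D.Covariance p.coaction S} (hK : K.IsCovariant C) (a b : ℕ) :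
    IsRelHopfHom (hK.onForms a b) (C.onForms (a + b)) (Submodule.inclusion (K.forms_le a b)) where
  op_smul _ _ := rfl
  coact ω := by
    apply lTensor_injective A (D.forms (a + b)).incl_injective
    have r := fun ω => C.δ.lTensor_restrictLin (D.forms (a + b)).incl
      (D.forms (a + b)).incl_injective (C.stable (a + b)) ω
    have r' := fun ω => C.δ.lTensor_restrictLin (K.forms a b).incl
      (K.forms a b).incl_injective (hK a b) ω
    rw [← LinearMap.lTensor_comp_apply]
    exact (r _).trans (r' ω).symm

theorem DiffCalculus.ComplexStructure.IsCovariant.isConjugateDecomposition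
    {K : D.ComplexStructure S} {C : D.Covariance p.coaction S} (hK : K.IsCovariant C) :
    IsConjugateDecomposition (C.onForms 1) (S.onForms 1) (hK.onForms 1 0) (hK.onForms 0 1)
      K.incl10 K.incl01 where
  decomp := by
    have hgr : D.gr 1 = K.bigr (1, 0) ⊔ K.bigr (0, 1) := by
      rw [K.gr_eq 1]
      apply le_antisymm
      · refine iSup_le fun a => iSup_le fun b => iSup_le fun hab => ?_
        obtain ⟨rfl, rfl⟩ | ⟨rfl, rfl⟩ : (a = 1 ∧ b = 0) ∨ (a = 0 ∧ b = 1) := by omega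
        · exact le_sup_left
        · exact le_sup_right
      · refine sup_le ?_ ?_
        · exact le_iSup_of_le 1 (le_iSup_of_le 0 (le_iSup_of_le rfl le_rfl))
        · exact le_iSup_of_le 0 (le_iSup_of_le 1 (le_iSup_of_le rfl le_rfl))
    have hdis : Disjoint (K.bigr (1, 0)) (K.bigr (0, 1)) :=
      K.isInternal.submodule_iSupIndep.pairwiseDisjoint (by simp)
    constructor
    · rintro ⟨x, y⟩ ⟨x', y'⟩ hxy
      have h : (x : D.Ω) + y = x' + y' := congrArg Subtype.val hxy
      have h1 : (x : D.Ω) - x' = y' - y := by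
        rw [sub_eq_sub_iff_add_eq_add, h, add_comm]
      have h2 : (x : D.Ω) - x' = 0 := (Submodule.disjoint_def.1 hdis) _
        ((K.bigr (1, 0)).sub_mem x.2 x'.2) (h1 ▸ (K.bigr (0, 1)).sub_mem y'.2 y.2)
      rw [h2] at h1
      exact Prod.ext (Subtype.ext (sub_eq_zero.1 h2)) (Subtype.ext (sub_eq_zero.1 h1.symm).symm)
    · rintro ⟨ω, hω⟩
      have hω' : ω ∈ K.bigr (1, 0) ⊔ K.bigr (0, 1) := hgr ▸ hω
      obtain ⟨x, hx, y, hy, rfl⟩ := Submodule.mem_sup.1 hω'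
      exact ⟨(⟨x, hx⟩, ⟨y, hy⟩), rfl⟩
  left := hK.isRelHopfHom 1 0
  right := hK.isRelHopfHom 0 1
  star_left e := by
    have : S.toLin e ∈ K.bigr (0, 1) := K.star_eq 1 0 ▸ Submodule.mem_map_of_mem e.2
    exact ⟨⟨_, this⟩, rfl⟩
  star_right f := by
    have : S.toLin f ∈ K.bigr (1, 0) := K.star_eq 0 1 ▸ Submodule.mem_map_of_mem f.2
    exact ⟨⟨_, this⟩, rfl⟩

end Forms

theorem IsIsoRelHopf.symm {A : Type u} [Ring A] [HopfAlgebra ℂ A] {B : Type u} [Ring B]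
    [Algebra ℂ B]
    {M : Type u} [AddCommGroup M] [Module ℂ M] [Module B M] [Module Bᵐᵒᵖ M]
    [IsScalarTower ℂ B M] [IsScalarTower ℂ Bᵐᵒᵖ M] [SMulCommClass B Bᵐᵒᵖ M]
    {N : Type u} [AddCommGroup N] [Module ℂ N] [Module B N] [Module Bᵐᵒᵖ N]
    [IsScalarTower ℂ B N] [IsScalarTower ℂ Bᵐᵒᵖ N] [SMulCommClass B Bᵐᵒᵖ N]
    {ρM : Coaction A M} {ρN : Coaction A N} (h : IsIsoRelHopf (B := B) ρM ρN) :
    IsIsoRelHopf (B := B) ρN ρM := by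
  obtain ⟨e, he, hρ⟩ := h
  refine ⟨e.symm, fun b n => ?_, fun n => ?_⟩
  · obtain ⟨m, rfl⟩ := e.surjective n
    rw [← he, e.symm_apply_apply, e.symm_apply_apply]
  · obtain ⟨m, rfl⟩ := e.surjective n
    have : e.symm.toLinearMap.restrictScalars ℂ ∘ₗ e.toLinearMap.restrictScalars ℂ =
      LinearMap.id := LinearMap.ext e.symm_apply_apply
    rw [e.symm_apply_apply, hρ, ← LinearMap.lTensor_comp_apply, this]
    simp

end QHS

end

theorem mainTheorem7 {A H : Type u}
    [Ring A] [HopfAlgebra ℂ A] [StarRing A] [StarModule ℂ A] [QHS.HopfStarAlgebra A]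
    [Ring H] [HopfAlgebra ℂ H] [StarRing H] [StarModule ℂ H] (hH : QHS.IsCQGAlgebra H)
    (p : QHS.HopfSurj A H) (hB : p.IsQuantumHomogeneousSpace)
    (D : QHS.DiffCalculus p.coinv) (S : D.StarStructure) (C : D.Covariance p.coaction S)
    (K : D.ComplexStructure S) (hK : K.IsCovariant C)
    (hΩ : QHS.IsModzObject p.augIdeal (D.forms 1))
    (h10 : QHS.IsSimpleModz p.augIdeal (hK.onForms 1 0))
    (h01 : QHS.IsSimpleModz p.augIdeal (hK.onForms 0 1))
    (hne : ¬ QHS.IsIsoRelHopf (B := p.coinv) (hK.onForms 1 0) (hK.onForms 0 1))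
    (G : QHS.Metric p.coinv (D.forms 1)) (hG : G.IsCovariant (C.isRelHopf_onForms 1))
    (hreal : G.IsReal (S.onForms 1)) :
    QHS.IsCovariantHermitianMetric p.coaction (C.onForms 1)
      (G.form (S.onForms 1) LinearMap.id) ∧
    QHS.IsCovariantHermitianMetric p.coaction (hK.onForms 1 0)
      (G.form (S.onForms 1) K.incl10) ∧
    QHS.IsCovariantHermitianMetric p.coaction (hK.onForms 0 1)
      (G.form (S.onForms 1) K.incl01) ∧
    QHS.IsDirectSum K.incl10 K.incl01 (G.form (S.onForms 1) LinearMap.id)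
      (G.form (S.onForms 1) K.incl10) (G.form (S.onForms 1) K.incl01) := by
  have h := hK.isConjugateDecomposition
  have hs := C.isStarColinear_onForms 1
  have hid : QHS.IsRelHopfHom (p := p) (C.onForms 1) (C.onForms 1) LinearMap.id :=
    ⟨fun _ _ => rfl, fun ω => by
      change _ = (LinearMap.id : D.forms 1 →ₗ[ℂ] D.forms 1).lTensor A _
      simp⟩
  have hj := h.isotropic_right hs hH hΩ hG h10 h01 hne
  have hi := h.symm.isotropic_right hs hH hΩ hG h01 h10 fun e => hne e.symm
  exact ⟨QHS.Metric.isCovariantHermitianMetric_form hid hs hG hreal G.bijective_form_id,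
    QHS.Metric.isCovariantHermitianMetric_form h.left hs hG hreal (h.bijective_form G hi hj),
    QHS.Metric.isCovariantHermitianMetric_form h.right hs hG hreal (h.symm.bijective_form G hj hi),
    h.isDirectSum G hi hj⟩
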